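/- An election $E=(C,V)$ consists of a finite set $C$ of $m$ candidates and a list $V=(v_1,\dots,v_n)$ of $n$ votes, each a total order over $C$; $\mathrm{pos}_v(c)\in\{1,\dots,m\}$ is the position of $c$ in $v$ (the top position is $1$). Let $\mathcal M_E(a,b)$ be the number of voters that prefer $a$ to $b$, let $\mathcal P_E(c)\in\mathbb R^m$ be the vector whose $i$-th entry is the number of voters that rank $c$ on position $i$, and let $\mathcal B_E(c)=\sum_{i=1}^n (m-\mathrm{pos}_{v_i}(c))$ be the Borda score of $c$. For vectors $x,y\in\mathbb R^m$ let $\ell_1(x,y)=\sum_i|x_i-y_i|$ and $\mathrm{emd}(x,y)=\ell_1(\hat x,\hat y)$, where $\hat x_i=x_1+\dots+x_i$. For votes $u,v$ over the same candidates let $d_{\mathrm{disc}}(u,v)$ be $0$ if $u=v$ and $1$ otherwise, and let $d_{\mathrm{swap}}(u,v)$ be the number of (unordered) pairs of candidates that $u$ and $v$ rank in opposite order. For elections $E=(C,V)$ and $E'=(C',V')$ with the same number $m$ of candidates and the same number $n$ of voters, let $\Pi(C,C')$ be the set of bijections from $C$ to $C'$ and $S_n$ the set of permutations of $\{1,\dots,n\}$;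 for $\sigma\in\Pi(C,C')$ let $\sigma(v)$ be the vote $v$ with each candidate $c$ replaced by $\sigma(c)$. Define: - swap and discrete metric: $d(E,E')=\min_{\sigma\in\Pi(C,C')}\min_{\rho\in S_n}\sum_{i=1}^n d(\sigma(v_i),v'_{\rho(i)})$, with $d=d_{\mathrm{swap}}$ and $d=d_{\mathrm{disc}}$ respectively; - EMD-positionwise metric: $\min_{\sigma\in\Pi(C,C')}\sum_{c\in C}\mathrm{emd}(\mathcal P_E(c),\mathcal P_{E'}(\sigma(c)))$; - $\ell_1$-positionwise metric: $\min_{\sigma\in\Pi(C,C')}\sum_{c\in C}\ell_1(\mathcal P_E(c),\mathcal P_{E'}(\sigma(c)))$; - pairwise metric: $\min_{\sigma\in\Pi(C,C')}\sum_{a\neq b}|\mathcal M_E(a,b)-\mathcal M_{E'}(\sigma(a),\sigma(b))|$, the sum being over ordered pairs of distinct candidates $a,b\in C$; - Bordawise metric: $\mathrm{emd}(\mathrm{sort}(\mathcal B_E),\mathrm{sort}(\mathcal B_{E'}))$, where $\mathrm{sort}$ arranges the entries in nonincreasing order. For a real number $\alpha$, such a metric $d$ is called $\alpha$-intrinsic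 if for every two elections $X,Y$ with the same number of candidates, the same number of voters and $d(X,Y)\neq 0$ there are elections $X=E_0,E_1,\dots,E_k=Y$ (with the same numbers of candidates and voters as $X$ and $Y$) such that $\sum_{i=1}^k d(E_{i-1},E_i)\le\alpha\cdot d(X,Y)$ and, for each $i\in\{1,\dots,k\}$, $d(E_{i-1},E_i)$ is the smallest nonzero distance between elections under $d$. It is intrinsic if it is $1$-intrinsic. Theorem. The swap and discrete metrics are intrinsic. None of the EMD-positionwise, $\ell_1$-positionwise, pairwise and Bordawise metrics is intrinsic. The EMD-positionwise and $\ell_1$-positionwise metrics are $2$-intrinsic, but not $\alpha$-intrinsic for any $\alpha<2$. -/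

import Mathlib

open scoped BigOperators

/-- A vote (preference order) over the candidate set `C`, `|C| = m`, as the ranking which sends a
candidate to its zero-based position: `0` is the top position and `m - 1` the bottom one. -/
abbrev Vote (C : Type) (m : ℕ) : Type := C ≃ Fin m

/-- An election with `m` candidates and `n` voters: a finite candidate set of size `m`, and a
preference profile, which lists one vote for each of the voters. -/
structure Election (m n : ℕ) : Type 1 where
  /-- the candidate set -/
  Cand : Type
  [fintypeCand : Fintype Cand]
  card_cand : Fintype.card Cand = m
  /-- the preference profile -/
  vote : Fin n → Vote Cand m

attribute [instance] Election.fintypeCand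

noncomputable section

/-! ### Aggregate representations -/

namespace Election

variable {m n : ℕ}

/-- The weighted majority relation: the number of voters who prefer `c` to `d`. -/
def majority (X : Election m n) (c d : X.Cand) : ℕ :=
  (Finset.univ.filter fun i : Fin n => X.vote i c < X.vote i d).card

/-- The position matrix: `X.position c j` is the number of voters who rank `c` on position `j`. -/
def position (X : Election m n) (c : X.Cand) (j : Fin m) : ℕ :=
  (Finset.univ.filter fun i : Fin n => X.vote i c = j).card

/-- The Borda score. With positions counted from one, a voter gives `m - pos` points. -/
def borda (X : Election m n) (c : X.Cand) : ℕ :=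
  ∑ i : Fin n, (m - ((X.vote i c : ℕ) + 1))

/-- The Borda score vector sorted in nonincreasing order (the sorted list has `m` entries, so the
default value `0` is never used). -/
def sortedBorda (X : Election m n) (j : Fin m) : ℕ :=
  ((Finset.univ.val.map X.borda).sort (· ≥ ·)).getD (j : ℕ) 0

end Election

/-! ### Metrics among vectors -/

/-- The `ℓ₁`-metric. -/
def l1Dist {m : ℕ} (x y : Fin m → ℝ) : ℝ := ∑ i, |x i - y i|

/-- The vector of prefix sums. -/
def prefixSum {m : ℕ} (x : Fin m → ℝ) (i : Fin m) : ℝ := ∑ j ∈ Finset.Iic i, x j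

/-- The earth mover's distance. -/
def emd {m : ℕ} (x y : Fin m → ℝ) : ℝ := l1Dist (prefixSum x) (prefixSum y)

/-! ### Metrics among votes -/

open Classical in
/-- The discrete distance of two votes. -/
def discVote {C : Type} [Fintype C] {m : ℕ} (u v : Vote C m) : ℝ := if u = v then 0 else 1

/-- The swap distance of two votes: the number of pairs of candidates ranked in opposite order. The
pair is listed in the order in which `u` ranks it, so that every pair is counted once. -/
def swapVote {C : Type} [Fintype C] {m : ℕ} (u v : Vote C m) : ℝ :=
  ((Finset.univ.filter fun p : C × C => u p.1 < u p.2 ∧ v p.2 < v p.1).card : ℝ)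

/-! ### Metrics among elections -/

/-- A distance is defined between elections with the same number of candidates and the same number
of voters. -/
abbrev ElectionDist : Type 1 := ∀ ⦃m n : ℕ⦄, Election m n → Election m n → ℝ

/-- `renameVote σ v` is the vote obtained from `v` by replacing each candidate `c` by `σ c`. -/
def renameVote {C D : Type} {m : ℕ} (σ : C ≃ D) (v : Vote C m) : Vote D m := σ.symm.trans v

/-- The discrete isomorphic metric. The infima here and below are minima: the index sets are finite,
and nonempty since the candidate sets have equal size. -/
def dDisc : ElectionDist := fun _ n X Y =>
  ⨅ σ : X.Cand ≃ Y.Cand, ⨅ ρ : Equiv.Perm (Fin n),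
    ∑ i, discVote (renameVote σ (X.vote i)) (Y.vote (ρ i))

/-- The swap isomorphic metric. -/
def dSwap : ElectionDist := fun _ n X Y =>
  ⨅ σ : X.Cand ≃ Y.Cand, ⨅ ρ : Equiv.Perm (Fin n),
    ∑ i, swapVote (renameVote σ (X.vote i)) (Y.vote (ρ i))

/-- The `ℓ₁`-positionwise metric. -/
def dPosL1 : ElectionDist := fun _ _ X Y =>
  ⨅ σ : X.Cand ≃ Y.Cand,
    ∑ c, l1Dist (fun j => (X.position c j : ℝ)) (fun j => (Y.position (σ c) j : ℝ))

/-- The EMD-positionwise metric. -/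
def dPosEMD : ElectionDist := fun _ _ X Y =>
  ⨅ σ : X.Cand ≃ Y.Cand,
    ∑ c, emd (fun j => (X.position c j : ℝ)) (fun j => (Y.position (σ c) j : ℝ))

open Classical in
/-- The pairwise metric. -/
def dPair : ElectionDist := fun _ _ X Y =>
  ⨅ σ : X.Cand ≃ Y.Cand,
    ∑ p ∈ (Finset.univ.filter fun p : X.Cand × X.Cand => p.1 ≠ p.2),
      |(X.majority p.1 p.2 : ℝ) - (Y.majority (σ p.1) (σ p.2) : ℝ)|

/-- The Bordawise metric. -/
def dBorda : ElectionDist := fun _ _ X Y =>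
  emd (fun j => (X.sortedBorda j : ℝ)) (fun j => (Y.sortedBorda j : ℝ))

/-! ### Intrinsicness -/

/-- `δ` is the smallest nonzero distance between elections under `d`. -/
def IsSmallestNonzeroDist (d : ElectionDist) (δ : ℝ) : Prop :=
  IsLeast {t : ℝ | t ≠ 0 ∧ ∃ (m n : ℕ) (X Y : Election m n), d X Y = t} δ

/-- `d` is `α`-intrinsic: elections `X` and `Y` of the same size that are not in the same
equivalence class of `d` are joined by a sequence of elections `X = E 0, …, E k = Y` of total length
at most `α * d X Y`, each step of which has the smallest nonzero length. -/
def IsAlphaIntrinsic (α : ℝ) (d : ElectionDist) : Prop :=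
  ∀ (m n : ℕ) (X Y : Election m n), d X Y ≠ 0 →
    ∃ (k : ℕ) (E : ℕ → Election m n), E 0 = X ∧ E k = Y ∧
      ∑ i ∈ Finset.range k, d (E i) (E (i + 1)) ≤ α * d X Y ∧
      ∀ i < k, IsSmallestNonzeroDist d (d (E i) (E (i + 1)))

/-- `d` is intrinsic. -/
def IsIntrinsic (d : ElectionDist) : Prop := IsAlphaIntrinsic 1 d

end

/-! For all metrics except the Bordawise one, the proof rests on `IsGapped`: a pseudometric on
elections whose nonzero values are at least `δ`. Under such a metric, steps of length at most `δ`,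
mixed with steps of length zero, compress to steps of length exactly `δ`. So `α`-intrinsicness
follows from walks of `k` such steps with `k * δ ≤ α * d X Y`. The gaps are 1 for swap and discrete,
4 for `ℓ₁`-positionwise, and 2 for EMD-positionwise and pairwise.

Swap and discrete: after an optimal renaming and reordering, votes are changed one at a time along
unit geodesics. For swaps, two different votes always have an inverted pair that is adjacent in the
first vote (`exists_adjacent_inversion`).

Positionwise, upper bound: by Hall's theorem, applied repeatedly, every natural matrix with all row
and column sums `n` is a position matrix (`IsPositionMatrix.exists_votes`), so it suffices to walk
among matrices. The basic move exchanges one unit between two rows and two columns. For `ℓ₁` a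
suitable exchange costs 4 and gains at least 2. For EMD a crossing of minimal width `g + 1` gains `2
* (g + 1)` and is realized by at most `2 * g + 1` exchanges in adjacent columns, each of cost at
most 2.

Positionwise, lower bound: a unanimous election is compared with one in which a single vote
deviates. Many unanimous votes make every matching of candidates other than the identity too
expensive. For `ℓ₁` the deviating vote is a cyclic rotation: a minimal step changes the matrix by
rank at most one, while the total change has rank one less than the number of candidates. For EMD
the deviating vote interchanges the first and last candidates: every middle row has to move away and
return, which nearly doubles the cost. Both ratios tend to 2.

Pairwise: two elections at distance 4, twice the gap, have an essentially unique optimal matching,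
and no majority relation strictly between them is realizable. Bordawise: distance 1 occurs with two
candidates, but some election with three candidates has nothing at distance 1. -/

/-! ### Walks between elections -/

/-- `StepWalk d δ k X Y`: `Y` is reached from `X` by `k` steps of length exactly `δ`. -/
inductive StepWalk (d : ElectionDist) (δ : ℝ) {m n : ℕ} :
    ℕ → Election m n → Election m n → Prop
  | nil (X : Election m n) : StepWalk d δ 0 X X
  | cons {k : ℕ} {X Y Z : Election m n} (h : d X Y = δ) (w : StepWalk d δ k Y Z) :
      StepWalk d δ (k + 1) X Z

/-- `Walk d δ k X Y`: `Y` is reached from `X` by `k` steps of length at most `δ`, and any number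
of steps of length zero. -/
inductive Walk (d : ElectionDist) (δ : ℝ) {m n : ℕ} :
    ℕ → Election m n → Election m n → Prop
  | nil (X : Election m n) : Walk d δ 0 X X
  | zero {k : ℕ} {X Y Z : Election m n} (h : d X Y = 0) (w : Walk d δ k Y Z) : Walk d δ k X Z
  | step {k : ℕ} {X Y Z : Election m n} (h : d X Y ≤ δ) (w : Walk d δ k Y Z) :
      Walk d δ (k + 1) X Z

lemma Walk.trans_zero {d : ElectionDist} {δ : ℝ} {m n k : ℕ} {X Y Z : Election m n}
    (w : Walk d δ k X Y) (h : d Y Z = 0) : Walk d δ k X Z := by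
  induction w with
  | nil => exact .zero h (.nil Z)
  | zero h' _ ih => exact .zero h' (ih h)
  | step h' _ ih => exact .step h' (ih h)

/-- Pseudometrics among elections whose nonzero values are at least `δ`. -/
structure IsGapped (d : ElectionDist) (δ : ℝ) : Prop where
  pos : 0 < δ
  self : ∀ {m n : ℕ} (X : Election m n), d X X = 0
  triangle : ∀ {m n : ℕ} (X Y Z : Election m n), d X Z ≤ d X Y + d Y Z
  gap : ∀ {m n : ℕ} (X Y : Election m n), d X Y ≠ 0 → δ ≤ d X Y

namespace IsGapped

variable {d : ElectionDist} {δ : ℝ} {m n : ℕ}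

lemma nonneg (hd : IsGapped d δ) (X Y : Election m n) : 0 ≤ d X Y := by
  by_cases h : d X Y = 0
  · exact h.ge
  · exact hd.pos.le.trans (hd.gap X Y h)

lemma eq_zero_or_eq (hd : IsGapped d δ) {X Y : Election m n} (h : d X Y ≤ δ) :
    d X Y = 0 ∨ d X Y = δ := by
  by_cases h0 : d X Y = 0
  · exact Or.inl h0
  · exact Or.inr (le_antisymm h (hd.gap X Y h0))

/-- A zero step followed by a step `δ` spans at most `δ` by the triangle inequality, hence exactly 0
or `δ`. In the first case the zero step is pushed further along the walk, in the second it is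
absorbed. Such absorption is needed because a chain must end at the given election, not merely at an
equivalent one. -/
lemma stepWalk_of_eq_zero (hd : IsGapped d δ) {k : ℕ} {Y Z : Election m n}
    (w : StepWalk d δ k Y Z) : ∀ {X : Election m n}, d X Y = 0 →
      d X Z = 0 ∨ ∃ k' ≤ k, StepWalk d δ k' X Z := by
  induction w with
  | nil Y => exact fun h => Or.inl h
  | @cons k Y Y' Z h w ih =>
    intro X hX
    have h1 : d X Y' ≤ δ := by
      have := hd.triangle X Y Y'
      rw [hX, h, zero_add] at this
      exact this
    rcases hd.eq_zero_or_eq h1 with h0 | h0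
    · rcases ih h0 with h2 | ⟨k', hk', w'⟩
      · exact Or.inl h2
      · exact Or.inr ⟨k', hk'.trans (Nat.le_succ k), w'⟩
    · exact Or.inr ⟨k + 1, le_rfl, .cons h0 w⟩

lemma stepWalk_of_le (hd : IsGapped d δ) {k : ℕ} {X Y Z : Election m n} (h : d X Y ≤ δ)
    (w : StepWalk d δ k Y Z) : d X Z = 0 ∨ ∃ k' ≤ k + 1, StepWalk d δ k' X Z := by
  rcases hd.eq_zero_or_eq h with h0 | h0
  · rcases hd.stepWalk_of_eq_zero w h0 with h2 | ⟨k', hk', w'⟩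
    · exact Or.inl h2
    · exact Or.inr ⟨k', hk'.trans (Nat.le_succ k), w'⟩
  · exact Or.inr ⟨k + 1, le_rfl, .cons h0 w⟩

lemma stepWalk_of_walk (hd : IsGapped d δ) {k : ℕ} {X Z : Election m n} (w : Walk d δ k X Z) :
    d X Z = 0 ∨ ∃ k' ≤ k, StepWalk d δ k' X Z := by
  induction w with
  | nil X => exact Or.inl (hd.self X)
  | @zero k X Y Z h w ih =>
    rcases ih with h0 | ⟨k', hk', w'⟩
    · left
      have h1 := hd.triangle X Y Z
      rw [h, h0, zero_add] at h1
      exact le_antisymm h1 (hd.nonneg X Z)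
    · rcases hd.stepWalk_of_eq_zero w' h with h2 | ⟨k'', hk'', w''⟩
      · exact Or.inl h2
      · exact Or.inr ⟨k'', hk''.trans hk', w''⟩
  | @step k X Y Z h w ih =>
    rcases ih with h0 | ⟨k', hk', w'⟩
    · have h1 := hd.triangle X Y Z
      rw [h0, add_zero] at h1
      rcases hd.eq_zero_or_eq (h1.trans h) with h2 | h2
      · exact Or.inl h2
      · exact Or.inr ⟨1, Nat.le_add_left 1 k, .cons h2 (.nil Z)⟩
    · rcases hd.stepWalk_of_le h w' with h2 | ⟨k'', hk'', w''⟩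
      · exact Or.inl h2
      · exact Or.inr ⟨k'', hk''.trans (Nat.succ_le_succ hk'), w''⟩

lemma isSmallest (hd : IsGapped d δ) {X Y : Election m n} (h : d X Y = δ) :
    IsSmallestNonzeroDist d δ := by
  refine ⟨⟨hd.pos.ne', m, n, X, Y, h⟩, ?_⟩
  rintro t ⟨ht, m', n', X', Y', rfl⟩
  exact hd.gap X' Y' ht

end IsGapped

lemma StepWalk.exists_seq {d : ElectionDist} {δ : ℝ} {m n : ℕ} {k : ℕ} {X Y : Election m n}
    (w : StepWalk d δ k X Y) :
    ∃ E : ℕ → Election m n, E 0 = X ∧ E k = Y ∧ ∀ i < k, d (E i) (E (i + 1)) = δ := by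
  induction w with
  | nil X => exact ⟨fun _ => X, rfl, rfl, fun i hi => absurd hi (Nat.not_lt_zero i)⟩
  | @cons k X Y Z h w ih =>
    obtain ⟨E, h0, hk, hE⟩ := ih
    refine ⟨fun i => Nat.casesOn i X E, rfl, hk, ?_⟩
    rintro (_ | i) hi
    · simpa [h0] using h
    · exact hE i (Nat.lt_of_succ_lt_succ hi)

theorem IsGapped.isAlphaIntrinsic {d : ElectionDist} {δ α : ℝ} (hd : IsGapped d δ)
    (hw : ∀ {m n : ℕ} (X Y : Election m n), ∃ k : ℕ, k * δ ≤ α * d X Y ∧ Walk d δ k X Y) :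
    IsAlphaIntrinsic α d := by
  intro m n X Y hXY
  obtain ⟨k, hk, w⟩ := hw X Y
  rcases hd.stepWalk_of_walk w with h | ⟨k', hk', w'⟩
  · exact absurd h hXY
  obtain ⟨E, h0, h1, hE⟩ := w'.exists_seq
  refine ⟨k', E, h0, h1, ?_, fun i hi => ?_⟩
  · rw [Finset.sum_congr rfl fun i hi => hE i (Finset.mem_range.1 hi), Finset.sum_const,
      Finset.card_range, nsmul_eq_mul]
    refine le_trans ?_ hk
    exact mul_le_mul_of_nonneg_right (by exact_mod_cast hk') hd.pos.le
  · rw [hE i hi]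
    exact hd.isSmallest (hE i hi)

lemma IsGapped.eq_of_isSmallest {d : ElectionDist} {δ ε : ℝ} (hd : IsGapped d δ)
    {m n : ℕ} {X Y : Election m n} (h0 : d X Y ≠ 0) (h1 : d X Y ≤ δ)
    (hε : IsSmallestNonzeroDist d ε) : ε = δ :=
  hε.unique (hd.isSmallest ((hd.eq_zero_or_eq h1).resolve_left h0))

/-- Identifies the smallest nonzero distance without an explicit example: any compressed walk
between elections at nonzero distance contains a step of length exactly `δ`. -/
lemma IsGapped.exists_eq {d : ElectionDist} {δ : ℝ} (hd : IsGapped d δ)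
    (hw : ∀ {m n : ℕ} (X Y : Election m n), ∃ k : ℕ, Walk d δ k X Y)
    {m n : ℕ} {X Y : Election m n} (h0 : d X Y ≠ 0) {ε : ℝ} (hε : IsSmallestNonzeroDist d ε) :
    ε = δ := by
  obtain ⟨k, w⟩ := hw X Y
  rcases hd.stepWalk_of_walk w with h | ⟨k', hk', w'⟩
  · exact absurd h h0
  · cases w' with
    | nil => exact absurd (hd.self X) h0
    | cons h _ => exact hε.unique (hd.isSmallest h)

namespace Election

variable {m n : ℕ}

instance nonempty_equiv (X Y : Election m n) : Nonempty (X.Cand ≃ Y.Cand) :=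
  ⟨Fintype.equivOfCardEq (X.card_cand.trans Y.card_cand.symm)⟩

/-- The election with candidates `C` and preference profile `P`. -/
abbrev ofVotes {C : Type} [Fintype C] (h : Fintype.card C = m) (P : Fin n → Vote C m) :
    Election m n where
  Cand := C
  card_cand := h
  vote := P

end Election

lemma finite_iInf_le {ι : Type*} [Finite ι] (f : ι → ℝ) (i : ι) : ⨅ j, f j ≤ f i :=
  ciInf_le (Set.finite_range f).bddBelow i

lemma renameVote_renameVote_symm {C D : Type} {m : ℕ} (σ : C ≃ D) (v : Vote D m) :
    renameVote σ (renameVote σ.symm v) = v := by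
  ext c
  simp [renameVote]

/-! ### Isomorphic metrics from metrics among votes -/

/-- A distance of two votes over the same candidates. -/
abbrev VoteDist : Type 1 := ∀ ⦃C : Type⦄ [Fintype C] ⦃m : ℕ⦄, Vote C m → Vote C m → ℝ

/-- The isomorphic metric that extends the distance `g` of votes. -/
noncomputable def isoVote (g : VoteDist) : ElectionDist := fun _ n X Y =>
  ⨅ σ : X.Cand ≃ Y.Cand, ⨅ ρ : Equiv.Perm (Fin n),
    ∑ i, g (renameVote σ (X.vote i)) (Y.vote (ρ i))

/-- A neutral integer-valued pseudometric among votes, in which every two distinct votes are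
connected by a geodesic of unit steps. -/
structure IsGeodesicVoteDist (g : VoteDist) : Prop where
  nat : ∀ {C : Type} [Fintype C] {m : ℕ} (u v : Vote C m), ∃ N : ℕ, g u v = N
  self : ∀ {C : Type} [Fintype C] {m : ℕ} (u : Vote C m), g u u = 0
  triangle : ∀ {C : Type} [Fintype C] {m : ℕ} (u v w : Vote C m), g u w ≤ g u v + g v w
  neutral : ∀ {C D : Type} [Fintype C] [Fintype D] {m : ℕ} (σ : C ≃ D) (u v : Vote C m),
    g (renameVote σ u) (renameVote σ v) = g u v
  step : ∀ {C : Type} [Fintype C] {m : ℕ} (u v : Vote C m), u ≠ v →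
    ∃ w, g u w ≤ 1 ∧ g w v + 1 ≤ g u v

section isoVote

variable {g : VoteDist} {m n : ℕ}

lemma isoVote_le (X Y : Election m n) (σ : X.Cand ≃ Y.Cand) (ρ : Equiv.Perm (Fin n)) :
    isoVote g X Y ≤ ∑ i, g (renameVote σ (X.vote i)) (Y.vote (ρ i)) :=
  (finite_iInf_le _ σ).trans (finite_iInf_le _ ρ)

lemma exists_isoVote_eq (g : VoteDist) (X Y : Election m n) :
    ∃ (σ : X.Cand ≃ Y.Cand) (ρ : Equiv.Perm (Fin n)),
      ∑ i, g (renameVote σ (X.vote i)) (Y.vote (ρ i)) = isoVote g X Y := by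
  obtain ⟨σ, hσ⟩ := exists_eq_ciInf_of_finite (f := fun σ : X.Cand ≃ Y.Cand =>
    ⨅ ρ : Equiv.Perm (Fin n), ∑ i, g (renameVote σ (X.vote i)) (Y.vote (ρ i)))
  obtain ⟨ρ, hρ⟩ := exists_eq_ciInf_of_finite (f := fun ρ : Equiv.Perm (Fin n) =>
    ∑ i, g (renameVote σ (X.vote i)) (Y.vote (ρ i)))
  exact ⟨σ, ρ, hρ.trans hσ⟩

namespace IsGeodesicVoteDist

variable (hg : IsGeodesicVoteDist g)
include hg

lemma nonneg {C : Type} [Fintype C] (u v : Vote C m) : 0 ≤ g u v := by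
  obtain ⟨N, hN⟩ := hg.nat u v
  rw [hN]
  exact N.cast_nonneg

lemma sum_nat {C : Type} [Fintype C] (P Q : Fin n → Vote C m) :
    ∃ N : ℕ, ∑ i, g (P i) (Q i) = N := by
  choose N hN using fun i => hg.nat (P i) (Q i)
  exact ⟨∑ i, N i, by simp [hN]⟩

lemma isoVote_nat (X Y : Election m n) : ∃ N : ℕ, isoVote g X Y = N := by
  obtain ⟨σ, ρ, h⟩ := exists_isoVote_eq g X Y
  rw [← h]
  exact hg.sum_nat (fun i => renameVote σ (X.vote i)) fun i => Y.vote (ρ i)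

lemma isGapped : IsGapped (isoVote g) 1 where
  pos := one_pos
  self X := by
    obtain ⟨N, hN⟩ := hg.isoVote_nat X X
    refine le_antisymm ((isoVote_le X X (Equiv.refl _) (Equiv.refl _)).trans ?_)
      (by rw [hN]; exact N.cast_nonneg)
    refine (Finset.sum_eq_zero fun i _ => ?_).le
    exact hg.self (X.vote i)
  triangle X Y Z := by
    obtain ⟨σ, ρ, h⟩ := exists_isoVote_eq g X Y
    obtain ⟨τ, π, h'⟩ := exists_isoVote_eq g Y Z
    refine (isoVote_le X Z (σ.trans τ) (ρ.trans π)).trans ?_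
    rw [← h, ← h', ← Equiv.sum_comp ρ fun i => g (renameVote τ (Y.vote i)) (Z.vote (π i)),
      ← Finset.sum_add_distrib]
    refine Finset.sum_le_sum fun i _ => ?_
    refine (hg.triangle _ (renameVote τ (Y.vote (ρ i))) _).trans ?_
    refine add_le_add (le_of_eq ?_) le_rfl
    exact hg.neutral τ (renameVote σ (X.vote i)) (Y.vote (ρ i))
  gap X Y h := by
    obtain ⟨N, hN⟩ := hg.isoVote_nat X Y
    rw [hN] at h ⊢
    exact_mod_cast Nat.one_le_iff_ne_zero.2 (by exact_mod_cast h)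

/-- Induction on a natural bound for the total distance: moving one differing vote one unit along
its geodesic lowers the sum by at least 1. -/
lemma walk_ofVotes {C : Type} [Fintype C] (hC : Fintype.card C = m) (Q : Fin n → Vote C m) :
    ∀ (N : ℕ) (P : Fin n → Vote C m), ∑ i, g (P i) (Q i) ≤ N →
      ∃ k : ℕ, (k : ℝ) ≤ ∑ i, g (P i) (Q i) ∧
        Walk (isoVote g) 1 k (Election.ofVotes hC P) (Election.ofVotes hC Q) := by
  intro N
  induction N with
  | zero =>
    intro P hP
    have h0 : ∑ i, g (P i) (Q i) = 0 :=
      le_antisymm (by simpa using hP) (Finset.sum_nonneg fun i _ => hg.nonneg _ _)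
    have : P = Q := by
      funext i
      by_contra h
      obtain ⟨w, -, hw⟩ := hg.step (P i) (Q i) h
      have := (Finset.sum_eq_zero_iff_of_nonneg fun i _ => hg.nonneg (P i) (Q i)).1 h0 i
        (Finset.mem_univ i)
      linarith [hg.nonneg w (Q i)]
    subst this
    exact ⟨0, by simp [h0], .nil _⟩
  | succ N ih =>
    intro P hP
    by_cases hPQ : P = Q
    · subst hPQ
      exact ⟨0, by simpa using Finset.sum_nonneg fun i _ => hg.nonneg (P i) (P i), .nil _⟩
    obtain ⟨i, hi⟩ := Function.ne_iff.1 hPQ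
    obtain ⟨w, hw1, hw2⟩ := hg.step (P i) (Q i) hi
    have hsum : ∑ j, g (Function.update P i w j) (Q j) + 1 ≤ ∑ j, g (P j) (Q j) := by
      rw [← Finset.add_sum_erase _ _ (Finset.mem_univ i),
        ← Finset.add_sum_erase _ (fun j => g (P j) (Q j)) (Finset.mem_univ i)]
      have : ∑ j ∈ Finset.univ.erase i, g (Function.update P i w j) (Q j) =
          ∑ j ∈ Finset.univ.erase i, g (P j) (Q j) := by
        refine Finset.sum_congr rfl fun j hj => ?_
        rw [Function.update_of_ne (Finset.ne_of_mem_erase hj)]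
      rw [this, Function.update_self]
      linarith
    push_cast at hP
    obtain ⟨k, hk, W⟩ := ih (Function.update P i w) (by linarith)
    refine ⟨k + 1, by push_cast; linarith, .step ?_ W⟩
    refine (isoVote_le (Election.ofVotes hC P) (Election.ofVotes hC (Function.update P i w))
      (Equiv.refl _) (Equiv.refl _)).trans ?_
    rw [Finset.sum_eq_single i]
    · simp only [Equiv.refl_apply, Function.update_self]
      exact hw1
    · intro j _ hj
      simp only [Equiv.refl_apply, Function.update_of_ne hj]
      exact hg.self (P j)
    · simp

lemma isoVote_rename_eq_zero (X Y : Election m n) (σ : X.Cand ≃ Y.Cand)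
    (ρ : Equiv.Perm (Fin n)) (Q : Fin n → Vote X.Cand m)
    (hQ : ∀ i, Q i = renameVote σ.symm (Y.vote (ρ i))) :
    isoVote g (Election.ofVotes X.card_cand Q) Y = 0 := by
  refine le_antisymm ((isoVote_le (Election.ofVotes X.card_cand Q) Y σ ρ).trans (le_of_eq ?_))
    (hg.isGapped.nonneg _ _)
  refine Finset.sum_eq_zero fun i _ => ?_
  change g (renameVote σ (Q i)) (Y.vote (ρ i)) = 0
  rw [hQ, renameVote_renameVote_symm]
  exact hg.self (Y.vote (ρ i))

theorem isIntrinsic : IsIntrinsic (isoVote g) := by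
  refine hg.isGapped.isAlphaIntrinsic fun {m n} X Y => ?_
  obtain ⟨σ, ρ, h⟩ := exists_isoVote_eq g X Y
  -- `Q` is the profile of `Y` pulled back along the optimal renaming and reordering, so the walk
  -- stays over the candidates of `X` and one zero step at the end leads to `Y`.
  obtain ⟨Q, hQ⟩ : ∃ Q : Fin n → Vote X.Cand m, ∀ i, Q i = renameVote σ.symm (Y.vote (ρ i)) :=
    ⟨_, fun i => rfl⟩
  have h2 : ∑ i, g (X.vote i) (Q i) = isoVote g X Y := by
    rw [← h]
    refine Finset.sum_congr rfl fun i _ => ?_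
    rw [← hg.neutral σ, hQ, renameVote_renameVote_symm]
  obtain ⟨N, hN⟩ := hg.sum_nat X.vote Q
  obtain ⟨k, hk, W⟩ := hg.walk_ofVotes X.card_cand Q N X.vote hN.le
  refine ⟨k, ?_, W.trans_zero (hg.isoVote_rename_eq_zero X Y σ ρ Q hQ)⟩
  rw [mul_one, one_mul, ← h2]
  exact hk

end IsGeodesicVoteDist

end isoVote

/-! ### The discrete and the swap metric -/

lemma isGeodesicVoteDist_discVote : IsGeodesicVoteDist @discVote where
  nat u v := by
    unfold discVote
    split_ifs
    · exact ⟨0, by simp⟩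
    · exact ⟨1, by simp⟩
  self u := by simp [discVote]
  triangle u v w := by
    unfold discVote
    split_ifs with h1 h2 h3 <;> simp_all
  neutral σ u v := by
    have : renameVote σ u = renameVote σ v ↔ u = v := by
      constructor
      · intro h
        ext c
        have := congrArg (fun w => w (σ c)) h
        simpa [renameVote] using congrArg Fin.val this
      · rintro rfl
        rfl
    simp [discVote, this]
  step u v h := ⟨v, by unfold discVote; split_ifs <;> simp, by simp [discVote, h]⟩

/-- Without such a pair, `v` after the inverse of `u` increases along consecutive positions, so it
is an order automorphism of `Fin m`, which can only be the identity. -/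
lemma exists_adjacent_inversion {C : Type} {m : ℕ} {u v : Vote C m} (h : u ≠ v) :
    ∃ a b : C, (u b : ℕ) = u a + 1 ∧ v b < v a := by
  by_contra! hc
  have hmono : ∀ (m' : ℕ), m = m' + 1 → u = v := by
    rintro m' rfl
    have h1 : StrictMono (u.symm.trans v) := by
      rw [Fin.strictMono_iff_lt_succ]
      intro i
      refine lt_of_le_of_ne (hc (u.symm i.castSucc) (u.symm i.succ) (by simp)) ?_
      intro h2
      have := (u.symm.trans v).injective h2
      simp [Fin.ext_iff] at this
    have h2 : (u.symm.trans v) = Equiv.refl _ := by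
      have := Subsingleton.elim (StrictMono.orderIsoOfSurjective _ h1 (u.symm.trans v).surjective)
        (OrderIso.refl (Fin (m' + 1)))
      ext i
      exact congrArg (fun f => ((f i : Fin (m' + 1)) : ℕ)) this
    ext c
    have := congrArg (fun f => (f (u c) : ℕ)) h2
    simpa using this.symm
  rcases m with _ | m'
  · exact h (by ext c; exact (u c).elim0)
  · exact h (hmono m' rfl)

lemma isGeodesicVoteDist_swapVote : IsGeodesicVoteDist @swapVote where
  nat u v := ⟨_, rfl⟩
  self u := by
    unfold swapVote
    rw [Finset.filter_false_of_mem]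
    · simp
    · rintro p - ⟨h1, h2⟩
      exact lt_asymm h1 h2
  triangle := by
    classical
    intro C _ m u v w
    unfold swapVote
    norm_cast
    refine le_trans (Finset.card_le_card (t := (Finset.univ.filter fun p : C × C =>
      u p.1 < u p.2 ∧ v p.2 < v p.1) ∪ (Finset.univ.filter fun p : C × C =>
      v p.1 < v p.2 ∧ w p.2 < w p.1)) ?_) (Finset.card_union_le _ _)
    rintro ⟨a, b⟩ h
    simp only [Finset.mem_filter, Finset.mem_univ, true_and, Finset.mem_union] at h ⊢
    rcases lt_trichotomy (v a) (v b) with h1 | h1 | h1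
    · exact Or.inr ⟨h1, h.2⟩
    · exact absurd (v.injective h1) (fun h2 => by simp [h2] at h)
    · exact Or.inl ⟨h.1, h1⟩
  neutral σ u v := by
    unfold swapVote
    norm_cast
    refine (Finset.card_bij (fun p _ => (σ p.1, σ p.2)) ?_ ?_ ?_).symm
    · rintro ⟨a, b⟩ h
      simp only [Finset.mem_filter, Finset.mem_univ, true_and] at h ⊢
      simpa [renameVote] using h
    · rintro ⟨a, b⟩ _ ⟨a', b'⟩ _ h
      simpa using h
    · rintro ⟨a, b⟩ h
      simp only [Finset.mem_filter, Finset.mem_univ, true_and] at h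
      refine ⟨(σ.symm a, σ.symm b), ?_, by simp⟩
      simp only [Finset.mem_filter, Finset.mem_univ, true_and]
      exact h
  step := by
    classical
    intro C _ m u v h
    obtain ⟨a, b, hab, hv⟩ := exists_adjacent_inversion h
    have hne : a ≠ b := by
      rintro rfl
      exact lt_irrefl _ hv
    let w : Vote C m := (Equiv.swap a b).trans u
    have hwa : w a = u b := by simp [w]
    have hwb : w b = u a := by simp [w]
    have hw : ∀ c, c ≠ a → c ≠ b → w c = u c := fun c h1 h2 => by
      simp [w, Equiv.swap_apply_of_ne_of_ne h1 h2]
    -- Since `a` and `b` are adjacent in `u`, every other candidate lies on the same side of both,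
    -- so interchanging them affects no other pair.
    have key : ∀ c d, (c, d) ≠ (a, b) → (c, d) ≠ (b, a) → (w c < w d ↔ u c < u d) := by
      have hinj : ∀ c, c ≠ a → c ≠ b → (u c : ℕ) ≠ u a ∧ (u c : ℕ) ≠ u b := fun c h1 h2 =>
        ⟨fun h => h1 (u.injective (Fin.ext h)), fun h => h2 (u.injective (Fin.ext h))⟩
      intro c d h1 h2
      by_cases hca : c = a <;> by_cases hcb : c = b <;> by_cases hda : d = a <;>
        by_cases hdb : d = b <;> subst_vars <;> try simp_all
      · have := hinj d hda hdb
        simp only [Fin.lt_def]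
        omega
      · have := hinj d hda hdb
        simp only [Fin.lt_def]
        omega
      · have := hinj c hca hcb
        simp only [Fin.lt_def]
        omega
      · have := hinj c hca hcb
        simp only [Fin.lt_def]
        omega
    have hu : u a < u b := by
      rw [Fin.lt_def]
      omega
    refine ⟨w, ?_, ?_⟩
    · unfold swapVote
      norm_cast
      refine (Finset.card_le_card (t := {(a, b)}) ?_).trans (by simp)
      · rintro ⟨c, d⟩ hcd
        simp only [Finset.mem_filter, Finset.mem_univ, true_and] at hcd
        rw [Finset.mem_singleton]
        by_contra h1
        by_cases h2 : (c, d) = (b, a)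
        · obtain ⟨rfl, rfl⟩ := Prod.mk.inj h2
          exact lt_asymm hu hcd.1
        · have h1' : (d, c) ≠ (b, a) := fun h => h1 (by simp_all)
          have h2' : (d, c) ≠ (a, b) := fun h => h2 (by simp_all)
          exact lt_asymm hcd.1 ((key d c h2' h1').1 hcd.2)
    · unfold swapVote
      norm_cast
      rw [Nat.succ_le_iff]
      refine Finset.card_lt_card ⟨?_, fun hsub => ?_⟩
      · rintro ⟨c, d⟩ hcd
        simp only [Finset.mem_filter, Finset.mem_univ, true_and] at hcd ⊢
        refine ⟨?_, hcd.2⟩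
        by_cases h1 : (c, d) = (a, b)
        · obtain ⟨rfl, rfl⟩ := Prod.mk.inj h1
          exact hu
        · by_cases h2 : (c, d) = (b, a)
          · obtain ⟨rfl, rfl⟩ := Prod.mk.inj h2
            exact absurd hcd.2 (lt_asymm hv)
          · exact (key c d h1 h2).1 hcd.1
      · have := @hsub (a, b) (by simp [hu, hv])
        simp only [Finset.mem_filter, Finset.mem_univ, true_and, hwa, hwb] at this
        exact lt_asymm hu this.1

theorem isIntrinsic_dDisc : IsIntrinsic dDisc := isGeodesicVoteDist_discVote.isIntrinsic

theorem isIntrinsic_dSwap : IsIntrinsic dSwap := isGeodesicVoteDist_swapVote.isIntrinsic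

/-! ### Vectors of equal sum -/

lemma exists_ne_of_sum_eq {ι : Type*} [Fintype ι] {f g : ι → ℕ}
    (h : ∑ i, f i = ∑ i, g i) {i : ι} (hi : f i ≠ g i) : ∃ j, j ≠ i ∧ f j ≠ g j := by
  classical
  by_contra! hc
  rw [← Finset.add_sum_erase _ _ (Finset.mem_univ i),
    ← Finset.add_sum_erase _ g (Finset.mem_univ i),
    Finset.sum_congr rfl fun c hc' => hc c (Finset.ne_of_mem_erase hc')] at h
  exact hi (Nat.add_right_cancel h)

lemma exists_lt_of_sum_eq {ι M : Type*} [Fintype ι] [AddCommMonoid M] [LinearOrder M]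
    [IsOrderedCancelAddMonoid M] {f g : ι → M} (h : ∑ i, f i = ∑ i, g i) (hfg : f ≠ g) :
    ∃ i, f i < g i := by
  by_contra! hc
  exact hfg (funext fun i =>
    ((Finset.sum_eq_sum_iff_of_le fun i _ => hc i).1 h.symm i (Finset.mem_univ i)).symm)

/-! ### Position matrices -/

/-- The position matrices of elections with `n` voters: all rows and columns have sum `n`. -/
structure IsPositionMatrix {C : Type} [Fintype C] {m : ℕ} (n : ℕ) (A : C → Fin m → ℕ) : Prop where
  row : ∀ c, ∑ j, A c j = n
  col : ∀ j, ∑ c, A c j = n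

lemma Election.position_eq_sum {m n : ℕ} (X : Election m n) (c : X.Cand) (j : Fin m) :
    X.position c j = ∑ i, if X.vote i c = j then 1 else 0 := by
  rw [Election.position, Finset.card_filter]

lemma Election.isPositionMatrix_position {m n : ℕ} (X : Election m n) : IsPositionMatrix n X.position where
  row c := by
    simp only [Election.position_eq_sum]
    rw [Finset.sum_comm]
    simp
  col j := by
    classical
    simp only [Election.position_eq_sum]
    rw [Finset.sum_comm]
    have : ∀ i (c : X.Cand), (X.vote i c = j) ↔ c = (X.vote i).symm j := fun i c =>
      (Equiv.eq_symm_apply _).symm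
    simp [this]

namespace IsPositionMatrix

variable {C : Type} [Fintype C] {m n : ℕ} {A : C → Fin m → ℕ}

lemma reindex {D : Type} [Fintype D] (hA : IsPositionMatrix n A) (σ : D ≃ C) :
    IsPositionMatrix n fun d => A (σ d) where
  row d := hA.row (σ d)
  col j := by rw [← hA.col j, Equiv.sum_comp σ fun c => A c j]

/-- Hall's condition by counting mass: the rows of `s` carry `s.card * (n + 1)` units, all in
columns that hold `n + 1` units each. -/
lemma exists_vote (hC : Fintype.card C = m) (hA : IsPositionMatrix (n + 1) A) :
    ∃ v : Vote C m, ∀ c, 1 ≤ A c (v c) := by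
  classical
  let t : C → Finset (Fin m) := fun c => Finset.univ.filter fun j => 1 ≤ A c j
  have hall : ∀ s : Finset C, s.card ≤ (s.biUnion t).card := by
    intro s
    have h1 : ∑ c ∈ s, ∑ j ∈ s.biUnion t, A c j = s.card * (n + 1) := by
      rw [← smul_eq_mul, ← Finset.sum_const]
      refine Finset.sum_congr rfl fun c hc => ?_
      rw [← hA.row c]
      refine Finset.sum_subset (Finset.subset_univ _) fun j _ hj => ?_
      by_contra h
      exact hj (Finset.mem_biUnion.2 ⟨c, hc, by simpa [t] using Nat.one_le_iff_ne_zero.2 h⟩)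
    have h2 : ∑ j ∈ s.biUnion t, ∑ c ∈ s, A c j ≤ (s.biUnion t).card * (n + 1) := by
      rw [← smul_eq_mul, ← Finset.sum_const]
      refine Finset.sum_le_sum fun j _ => ?_
      rw [← hA.col j]
      exact Finset.sum_le_sum_of_subset (Finset.subset_univ s)
    rw [Finset.sum_comm, h1] at h2
    exact Nat.le_of_mul_le_mul_right h2 n.succ_pos
  obtain ⟨f, hf, hft⟩ := (Finset.all_card_le_biUnion_card_iff_exists_injective t).1 hall
  have hb : Function.Bijective f :=
    (Fintype.bijective_iff_injective_and_card f).2 ⟨hf, by simp [hC]⟩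
  exact ⟨Equiv.ofBijective f hb, fun c => by simpa [t] using hft c⟩

/-- Peel off one permutation matrix per voter; what remains has row and column sums smaller by one.
-/
theorem exists_votes (hC : Fintype.card C = m) :
    ∀ {n : ℕ} {A : C → Fin m → ℕ}, IsPositionMatrix n A → ∃ P : Fin n → Vote C m,
      (Election.ofVotes hC P).position = A := by
  classical
  intro n
  induction n with
  | zero =>
    intro A hA
    refine ⟨Fin.elim0, ?_⟩
    funext c j
    have := (Finset.sum_eq_zero_iff.1 (hA.row c)) j (Finset.mem_univ j)
    rw [Election.position_eq_sum, this]
    simp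
  | succ n ih =>
    intro A hA
    obtain ⟨v, hv⟩ := hA.exists_vote hC
    have hle : ∀ c j, (if v c = j then 1 else 0) ≤ A c j := by
      intro c j
      split_ifs with h
      · exact h ▸ hv c
      · exact Nat.zero_le _
    have hA' : IsPositionMatrix n fun c j => A c j - if v c = j then 1 else 0 := by
      constructor
      · intro c
        have h := hA.row c
        rw [Finset.sum_tsub_distrib _ fun j _ => hle c j, h]
        simp
      · intro j
        have h := hA.col j
        rw [Finset.sum_tsub_distrib _ fun c _ => hle c j, h]
        have : ∀ c, v c = j ↔ c = v.symm j := fun c => (Equiv.eq_symm_apply _).symm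
        simp [this]
    obtain ⟨P, hP⟩ := ih hA'
    refine ⟨Fin.cons v P, ?_⟩
    funext c j
    have h := congrFun (congrFun hP c) j
    rw [Election.position_eq_sum] at h ⊢
    have h2 := hle c j
    rw [Fin.sum_univ_succ]
    simp only [Fin.cons_zero, Fin.cons_succ] at h ⊢
    omega

end IsPositionMatrix

/-! ### Positionwise metrics -/

/-- A distance of vectors. -/
abbrev VecDist : Type := ∀ ⦃m : ℕ⦄, (Fin m → ℝ) → (Fin m → ℝ) → ℝ

/-- The total distance `φ` between corresponding rows of two matrices. -/
noncomputable def matDist (φ : VecDist) {C : Type} [Fintype C] {m : ℕ} (A B : C → Fin m → ℕ) : ℝ :=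
  ∑ c, φ (fun j => (A c j : ℝ)) (fun j => (B c j : ℝ))

/-- The positionwise metric based on the distance `φ` of vectors. -/
noncomputable def dPos (φ : VecDist) : ElectionDist := fun _ _ X Y =>
  ⨅ σ : X.Cand ≃ Y.Cand, matDist φ X.position fun c => Y.position (σ c)

/-- Pseudometrics among vectors such that distinct natural vectors of equal sum have distance at
least `δ / 2`. -/
structure IsGappedVecDist (φ : VecDist) (δ : ℝ) : Prop where
  pos : 0 < δ
  self : ∀ {m : ℕ} (x : Fin m → ℝ), φ x x = 0
  nonneg : ∀ {m : ℕ} (x y : Fin m → ℝ), 0 ≤ φ x y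
  triangle : ∀ {m : ℕ} (x y z : Fin m → ℝ), φ x z ≤ φ x y + φ y z
  gap : ∀ {m : ℕ} (x y : Fin m → ℕ), ∑ j, x j = ∑ j, y j → x ≠ y →
    δ / 2 ≤ φ (fun j => (x j : ℝ)) fun j => (y j : ℝ)

section dPos

variable {φ : VecDist} {m n : ℕ}

lemma dPos_le (X Y : Election m n) (σ : X.Cand ≃ Y.Cand) :
    dPos φ X Y ≤ matDist φ X.position fun c => Y.position (σ c) :=
  finite_iInf_le _ σ

lemma exists_dPos_eq (φ : VecDist) (X Y : Election m n) : ∃ σ : X.Cand ≃ Y.Cand,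
    (matDist φ X.position fun c => Y.position (σ c)) = dPos φ X Y :=
  exists_eq_ciInf_of_finite

lemma matDist_reindex {C D : Type} [Fintype C] [Fintype D] (σ : D ≃ C) (A B : C → Fin m → ℕ) :
    (matDist φ (fun d => A (σ d)) fun d => B (σ d)) = matDist φ A B :=
  Equiv.sum_comp σ fun c => φ (fun j => (A c j : ℝ)) (fun j => (B c j : ℝ))

/-- `MatWalk φ δ n k A B`: the matrix `B` is reached from `A` by `k` steps of length at most `δ`
among regular matrices. -/
inductive MatWalk (φ : VecDist) (δ : ℝ) {C : Type} [Fintype C] {m : ℕ} (n : ℕ) :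
    ℕ → (C → Fin m → ℕ) → (C → Fin m → ℕ) → Prop
  | nil (A : C → Fin m → ℕ) : MatWalk φ δ n 0 A A
  | step {k : ℕ} {A B D : C → Fin m → ℕ} (hB : IsPositionMatrix n B) (h : matDist φ A B ≤ δ)
      (w : MatWalk φ δ n k B D) : MatWalk φ δ n (k + 1) A D

lemma MatWalk.trans {δ : ℝ} {C : Type} [Fintype C] {k l : ℕ} {A B D : C → Fin m → ℕ}
    (w : MatWalk φ δ n k A B) (w' : MatWalk φ δ n l B D) : MatWalk φ δ n (k + l) A D := by
  induction w with
  | nil => simpa using w'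
  | @step k _ _ _ hB h _ ih =>
    rw [Nat.add_right_comm]
    exact .step hB h (ih w')

lemma MatWalk.isPositionMatrix {δ : ℝ} {C : Type} [Fintype C] {k : ℕ} {A B : C → Fin m → ℕ}
    (w : MatWalk φ δ n k A B) (hA : IsPositionMatrix n A) : IsPositionMatrix n B := by
  induction w with
  | nil => exact hA
  | step hB _ _ ih => exact ih hB

namespace IsGappedVecDist

variable {δ : ℝ} (hφ : IsGappedVecDist φ δ)
include hφ

lemma matDist_nonneg {C : Type} [Fintype C] (A B : C → Fin m → ℕ) : 0 ≤ matDist φ A B :=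
  Finset.sum_nonneg fun _ _ => hφ.nonneg _ _

lemma matDist_self {C : Type} [Fintype C] (A : C → Fin m → ℕ) : matDist φ A A = 0 :=
  Finset.sum_eq_zero fun _ _ => hφ.self _

lemma matDist_triangle {C : Type} [Fintype C] (A B D : C → Fin m → ℕ) :
    matDist φ A D ≤ matDist φ A B + matDist φ B D := by
  unfold matDist
  rw [← Finset.sum_add_distrib]
  exact Finset.sum_le_sum fun _ _ => hφ.triangle _ _ _

/-- Equal column sums prevent a single row from differing alone. At least two rows differ, which is
why `IsGappedVecDist` asks for only `δ / 2` per row. -/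
lemma le_matDist {C : Type} [Fintype C] {A B : C → Fin m → ℕ} (hA : IsPositionMatrix n A)
    (hB : IsPositionMatrix n B) (h : A ≠ B) : δ ≤ matDist φ A B := by
  classical
  obtain ⟨a, ha⟩ := Function.ne_iff.1 h
  obtain ⟨j, hj⟩ := Function.ne_iff.1 ha
  obtain ⟨b, hb, hab⟩ := exists_ne_of_sum_eq ((hA.col j).trans (hB.col j).symm) hj
  have hrow : ∀ c, A c ≠ B c → δ / 2 ≤ φ (fun j => (A c j : ℝ)) fun j => (B c j : ℝ) :=
    fun c hc => hφ.gap _ _ ((hA.row c).trans (hB.row c).symm) hc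
  have h1 := hrow a ha
  have h2 := hrow b (fun h => hab (congrFun h j))
  have h3 : ∑ c ∈ {a, b}, φ (fun j => (A c j : ℝ)) (fun j => (B c j : ℝ)) ≤ matDist φ A B :=
    Finset.sum_le_sum_of_subset_of_nonneg (Finset.subset_univ _) fun _ _ _ => hφ.nonneg _ _
  rw [Finset.sum_pair hb.symm] at h3
  linarith

lemma isGapped : IsGapped (dPos φ) δ where
  pos := hφ.pos
  self X := by
    obtain ⟨σ, hσ⟩ := exists_dPos_eq φ X X
    refine le_antisymm ((dPos_le X X (Equiv.refl _)).trans (hφ.matDist_self _).le) ?_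
    rw [← hσ]
    exact hφ.matDist_nonneg _ _
  triangle X Y Z := by
    obtain ⟨σ, hσ⟩ := exists_dPos_eq φ X Y
    obtain ⟨τ, hτ⟩ := exists_dPos_eq φ Y Z
    refine (dPos_le X Z (σ.trans τ)).trans ?_
    rw [← hσ, ← hτ, ← matDist_reindex σ]
    exact hφ.matDist_triangle _ _ _
  gap X Y h := by
    obtain ⟨σ, hσ⟩ := exists_dPos_eq φ X Y
    rw [← hσ] at h ⊢
    refine hφ.le_matDist X.isPositionMatrix_position (Y.isPositionMatrix_position.reindex σ) fun h' => h ?_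
    rw [← h']
    exact hφ.matDist_self _

/-- Intermediate matrices are realized by elections over the label set `C`. Elections with equal
labelled matrices are at distance zero, which settles the last step to `Y`. -/
lemma walk_of_matWalk {C : Type} [Fintype C] {k : ℕ} {A B : C → Fin m → ℕ}
    (w : MatWalk φ δ n k A B) : ∀ (X Y : Election m n) (σ : C ≃ X.Cand) (τ : C ≃ Y.Cand),
      (fun c => X.position (σ c)) = A → (fun c => Y.position (τ c)) = B →
        Walk (dPos φ) δ k X Y := by
  have hle : ∀ (X Y : Election m n) (σ : C ≃ X.Cand) (τ : C ≃ Y.Cand), dPos φ X Y ≤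
      matDist φ (fun c => X.position (σ c)) fun c => Y.position (τ c) := by
    intro X Y σ τ
    refine (dPos_le X Y (σ.symm.trans τ)).trans ?_
    rw [← matDist_reindex σ]
    simp
  induction w with
  | nil A =>
    intro X Y σ τ hX hY
    refine .zero (Y := Y) (le_antisymm ?_ (hφ.isGapped.nonneg X Y)) (.nil Y)
    refine (hle X Y σ τ).trans ?_
    rw [hX, hY]
    exact (hφ.matDist_self A).le
  | @step k A B D hB h w ih =>
    intro X Y σ τ hX hY
    have hC : Fintype.card C = m := (Fintype.card_congr σ).trans X.card_cand
    obtain ⟨P, hP⟩ := IsPositionMatrix.exists_votes hC hB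
    refine .step ((hle X (Election.ofVotes hC P) σ (Equiv.refl C)).trans ?_)
      (ih (Election.ofVotes hC P) Y (Equiv.refl C) τ hP hY)
    rw [hX]
    exact (le_of_eq (congrArg _ hP)).trans h

lemma exists_walk {α : ℝ} (hstep : ∀ {C : Type} [Fintype C] {m n : ℕ} {A B : C → Fin m → ℕ},
      IsPositionMatrix n A → IsPositionMatrix n B → A ≠ B → ∃ (k : ℕ) (A' : C → Fin m → ℕ),
        MatWalk φ δ n k A A' ∧ k * δ ≤ α * (matDist φ A B - matDist φ A' B) ∧
          matDist φ A' B + 1 ≤ matDist φ A B) (X Y : Election m n) :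
    ∃ k : ℕ, k * δ ≤ α * dPos φ X Y ∧ Walk (dPos φ) δ k X Y := by
  obtain ⟨σ, hσ⟩ := exists_dPos_eq φ X Y
  -- Each stage lowers the real distance by at least 1, so induction on a natural bound terminates;
  -- at bound 0 the gap forces equality of the matrices.
  have key : ∀ (N : ℕ) (A : X.Cand → Fin m → ℕ), IsPositionMatrix n A →
      (matDist φ A fun c => Y.position (σ c)) ≤ N →
      ∃ k : ℕ, k * δ ≤ α * (matDist φ A fun c => Y.position (σ c)) ∧
        MatWalk φ δ n k A fun c => Y.position (σ c) := by
    intro N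
    induction N with
    | zero =>
      intro A hA hN
      by_cases hAB : A = fun c => Y.position (σ c)
      · subst hAB
        exact ⟨0, by simp [hφ.matDist_self], .nil _⟩
      · have := hφ.le_matDist hA (Y.isPositionMatrix_position.reindex σ) hAB
        have := hφ.pos
        push_cast at hN
        linarith
    | succ N ih =>
      intro A hA hN
      by_cases hAB : A = fun c => Y.position (σ c)
      · subst hAB
        exact ⟨0, by simp [hφ.matDist_self], .nil _⟩
      · obtain ⟨k, A', w, hk, h1⟩ := hstep hA (Y.isPositionMatrix_position.reindex σ) hAB
        push_cast at hN
        obtain ⟨l, hl, w'⟩ := ih A' (w.isPositionMatrix hA) (by linarith)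
        refine ⟨k + l, ?_, w.trans w'⟩
        push_cast
        linarith
  obtain ⟨N, hN⟩ := exists_nat_ge (dPos φ X Y)
  obtain ⟨k, hk, w⟩ := key N X.position X.isPositionMatrix_position (hσ.le.trans hN)
  exact ⟨k, by rw [← hσ]; exact hk, hφ.walk_of_matWalk w X Y (Equiv.refl _) σ rfl rfl⟩

end IsGappedVecDist

end dPos

/-! ### Exchanging two units of mass -/

/-- `A'` is obtained from `A` by moving one unit of row `a` from column `i` to column `j`, and one
unit of row `b` from column `j` to column `i`. -/
def IsExchange {C : Type} [DecidableEq C] {m : ℕ} (A A' : C → Fin m → ℕ) (a b : C)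
    (i j : Fin m) : Prop :=
  ∀ c t, (A' c t : ℤ) = A c t +
    ((if c = b then 1 else 0) - if c = a then 1 else 0) *
      ((if t = i then 1 else 0) - if t = j then 1 else 0)

section exchange

variable {C : Type} [DecidableEq C] {m n : ℕ} {A A' : C → Fin m → ℕ} {a b : C}
  {i j : Fin m}

lemma exists_isExchange (hai : 1 ≤ A a i) (hbj : 1 ≤ A b j) (hab : a ≠ b) (hij : i ≠ j) :
    ∃ A', IsExchange A A' a b i j := by
  have : ∀ c t, ∃ x : ℕ, (x : ℤ) = A c t +
    ((if c = b then 1 else 0) - if c = a then 1 else 0) *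
      ((if t = i then 1 else 0) - if t = j then 1 else 0) := by
    intro c t
    -- Only the entries `(a, i)` and `(b, j)` decrease, and both are positive.
    refine ⟨Int.toNat _, Int.toNat_of_nonneg ?_⟩
    split_ifs <;> subst_vars <;> first | contradiction | omega
  choose A' hA' using this
  exact ⟨A', hA'⟩

lemma IsExchange.isPositionMatrix [Fintype C] (h : IsExchange A A' a b i j) (hA : IsPositionMatrix n A) :
    IsPositionMatrix n A' where
  row c := by
    have := hA.row c
    zify at this ⊢
    simp only [h c, Finset.sum_add_distrib, this, ← Finset.mul_sum, Finset.sum_sub_distrib,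
      Finset.sum_ite_eq', Finset.mem_univ, if_true, sub_self, mul_zero, add_zero]
  col t := by
    have := hA.col t
    zify at this ⊢
    simp only [h _ t, Finset.sum_add_distrib, this, ← Finset.sum_mul, Finset.sum_sub_distrib,
      Finset.sum_ite_eq', Finset.mem_univ, if_true, sub_self, zero_mul, add_zero]

end exchange

/-! ### The `ℓ₁`-distance -/

lemma isGappedVecDist_l1Dist : IsGappedVecDist @l1Dist 4 where
  pos := by norm_num
  self x := by simp [l1Dist]
  nonneg x y := Finset.sum_nonneg fun i _ => abs_nonneg _
  triangle x y z := by
    unfold l1Dist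
    rw [← Finset.sum_add_distrib]
    exact Finset.sum_le_sum fun i _ => abs_sub_le _ _ _
  gap x y h hxy := by
    classical
    obtain ⟨i, hi⟩ := Function.ne_iff.1 hxy
    obtain ⟨j, hji, hj⟩ := exists_ne_of_sum_eq h hi
    have h1 : ∀ i, x i ≠ y i → (1 : ℝ) ≤ |(x i : ℝ) - y i| := by
      intro i hi
      have : (1 : ℤ) ≤ |(x i : ℤ) - y i| := Int.one_le_abs (by omega)
      exact_mod_cast this
    have h3 : ∑ i ∈ {i, j}, |(x i : ℝ) - y i| ≤ ∑ i, |(x i : ℝ) - y i| :=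
      Finset.sum_le_sum_of_subset_of_nonneg (Finset.subset_univ _) fun _ _ _ => abs_nonneg _
    rw [Finset.sum_pair hji.symm] at h3
    unfold l1Dist
    linarith [h1 i hi, h1 j hj]

lemma matDist_l1Dist {C : Type} [Fintype C] {m : ℕ} (A B : C → Fin m → ℕ) :
    matDist @l1Dist A B = ((∑ c, ∑ t, |(A c t : ℤ) - B c t| : ℤ) : ℝ) := by
  simp [matDist, l1Dist]

section exchange

variable {C : Type} [Fintype C] [DecidableEq C] {m n : ℕ} {A A' B : C → Fin m → ℕ} {a b : C}
  {i j : Fin m}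

lemma IsExchange.matDist_l1Dist_le (h : IsExchange A A' a b i j) :
    matDist @l1Dist A A' ≤ 4 := by
  rw [matDist_l1Dist]
  have : ∑ c, ∑ t, |(A c t : ℤ) - A' c t| ≤ ∑ c, ∑ t,
      (((if c = b then 1 else 0) + if c = a then 1 else 0) *
        ((if t = i then 1 else 0) + if t = j then 1 else 0) : ℤ) := by
    refine Finset.sum_le_sum fun c _ => Finset.sum_le_sum fun t _ => ?_
    rw [h c t, sub_add_cancel_left, abs_neg, abs_mul]
    refine mul_le_mul ?_ ?_ (abs_nonneg _) ?_ <;> split_ifs <;> simp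
  simp only [← Finset.mul_sum, ← Finset.sum_mul, Finset.sum_add_distrib, Finset.sum_ite_eq',
    Finset.mem_univ, if_true] at this
  norm_num at this
  exact_mod_cast this

/-- Three of the four changed entries, `(a, i)`, `(a, j)` and `(b, j)`, move towards `B` by one; the
entry `(b, i)` moves away by at most one. The net gain is 2. -/
lemma IsExchange.matDist_l1Dist_add_two_le (h : IsExchange A A' a b i j) (hab : a ≠ b)
    (hij : i ≠ j) (h1 : B a i < A a i) (h2 : A a j < B a j) (h3 : B b j < A b j) :
    matDist @l1Dist A' B + 2 ≤ matDist @l1Dist A B := by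
  rw [matDist_l1Dist, matDist_l1Dist]
  have : ∑ c, ∑ t, |(A' c t : ℤ) - B c t| ≤ ∑ c, ∑ t, (|(A c t : ℤ) - B c t| +
      ((if c = b then 1 else 0) * ((if t = i then 1 else 0) - if t = j then 1 else 0) -
        (if c = a then 1 else 0) * ((if t = i then 1 else 0) + if t = j then 1 else 0))) := by
    refine Finset.sum_le_sum fun c _ => Finset.sum_le_sum fun t _ => ?_
    rw [h c t]
    have key : ∀ x : ℤ, |x + 1| ≤ |x| + 1 ∧ (x < 0 → |x + 1| ≤ |x| - 1) ∧
        (0 < x → |x + -1| ≤ |x| - 1) := by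
      intro x
      refine ⟨by simpa using abs_add_le x 1, fun hx => ?_, fun hx => ?_⟩
      · rw [abs_of_nonpos (by omega), abs_of_neg hx]
        omega
      · rw [abs_of_nonneg (by omega), abs_of_pos hx]
        omega
    have := key ((A c t : ℤ) - B c t)
    rw [add_sub_right_comm]
    obtain ⟨k1, k2, k3⟩ := this
    split_ifs <;> subst_vars <;> norm_num <;> first
      | contradiction
      | exact k1
      | exact k2 (by omega)
      | exact k3 (by omega)
      | exact Int.le_sub_one_iff.1 (k2 (by omega))
      | exact Int.le_sub_one_iff.1 (k3 (by omega))
  simp only [← Finset.mul_sum, Finset.sum_sub_distrib, Finset.sum_add_distrib, ← Finset.sum_mul,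
    Finset.sum_ite_eq', Finset.mem_univ, if_true] at this
  norm_num at this
  have h4 : (∑ c, ∑ t, |(A' c t : ℤ) - B c t|) + 2 ≤ ∑ c, ∑ t, |(A c t : ℤ) - B c t| := by
    linarith
  exact_mod_cast h4

end exchange

lemma exists_matWalk_l1Dist {C : Type} [Fintype C] {m n : ℕ} {A B : C → Fin m → ℕ}
    (hA : IsPositionMatrix n A) (hB : IsPositionMatrix n B) (hAB : A ≠ B) :
    ∃ (k : ℕ) (A' : C → Fin m → ℕ), MatWalk @l1Dist 4 n k A A' ∧
      k * 4 ≤ 2 * (matDist @l1Dist A B - matDist @l1Dist A' B) ∧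
        matDist @l1Dist A' B + 1 ≤ matDist @l1Dist A B := by
  classical
  obtain ⟨a, ha⟩ := Function.ne_iff.1 hAB
  obtain ⟨i, hi⟩ := exists_lt_of_sum_eq ((hB.row a).trans (hA.row a).symm) ha.symm
  obtain ⟨j, hj⟩ := exists_lt_of_sum_eq ((hA.row a).trans (hB.row a).symm) ha
  obtain ⟨b, hb⟩ := exists_lt_of_sum_eq (f := fun c => B c j) (g := fun c => A c j)
    ((hB.col j).trans (hA.col j).symm) fun h => hj.ne (congrFun h a).symm
  have hab : a ≠ b := by
    rintro rfl
    exact lt_asymm hj hb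
  have hij : i ≠ j := by
    rintro rfl
    exact lt_asymm hi hj
  obtain ⟨A', h⟩ := exists_isExchange (A := A) (a := a) (b := b) (i := i) (j := j)
    (Nat.one_le_of_lt hi) (Nat.one_le_of_lt hb) hab hij
  have h2 := h.matDist_l1Dist_add_two_le hab hij hi hj hb
  refine ⟨1, A', .step (h.isPositionMatrix hA) h.matDist_l1Dist_le (.nil A'), ?_, ?_⟩
  · push_cast
    linarith
  · linarith

lemma exists_walk_dPosL1 {m n : ℕ} (X Y : Election m n) :
    ∃ k : ℕ, k * 4 ≤ 2 * dPosL1 X Y ∧ Walk dPosL1 4 k X Y :=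
  isGappedVecDist_l1Dist.exists_walk exists_matWalk_l1Dist X Y

lemma isGapped_dPosL1 : IsGapped dPosL1 4 := isGappedVecDist_l1Dist.isGapped

theorem isAlphaIntrinsic_dPosL1 : IsAlphaIntrinsic 2 dPosL1 :=
  isGapped_dPosL1.isAlphaIntrinsic exists_walk_dPosL1

/-! ### The earth mover's distance -/

/-- The sum of the first `t` entries. -/
def partialSum {m : ℕ} (x : Fin m → ℕ) (t : ℕ) : ℤ :=
  ∑ j ∈ Finset.univ.filter fun j : Fin m => (j : ℕ) < t, (x j : ℤ)

section partialSum

variable {m : ℕ}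

lemma partialSum_zero (x : Fin m → ℕ) : partialSum x 0 = 0 := by simp [partialSum]

lemma partialSum_self (x : Fin m → ℕ) : partialSum x m = ∑ j, (x j : ℤ) := by simp [partialSum]

lemma partialSum_succ (x : Fin m → ℕ) (j : Fin m) :
    partialSum x (j + 1) = partialSum x j + x j := by
  have : (Finset.univ.filter fun i : Fin m => (i : ℕ) < j + 1) =
      insert j (Finset.univ.filter fun i : Fin m => (i : ℕ) < j) := by
    ext i
    simp [Fin.ext_iff]
    omega
  rw [partialSum, this, Finset.sum_insert (by simp), add_comm]
  rfl

lemma sum_partialSum {C : Type} [Fintype C] {n : ℕ} {A : C → Fin m → ℕ}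
    (hA : IsPositionMatrix n A) (t : ℕ) : ∑ c, partialSum (A c) t =
      ∑ _j ∈ Finset.univ.filter fun j : Fin m => (j : ℕ) < t, (n : ℤ) := by
  unfold partialSum
  rw [Finset.sum_comm]
  exact Finset.sum_congr rfl fun j _ => by exact_mod_cast hA.col j

lemma partialSum_eq_prefixSum (x : Fin m → ℕ) (i : Fin m) :
    (partialSum x (i + 1) : ℝ) = prefixSum (fun j => (x j : ℝ)) i := by
  unfold partialSum prefixSum
  push_cast
  refine Finset.sum_congr ?_ fun _ _ => rfl
  ext j
  simp only [Finset.mem_filter, Finset.mem_univ, true_and, Finset.mem_Iic, Fin.le_def]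
  omega

lemma emd_eq (x y : Fin m → ℕ) : emd (fun j => (x j : ℝ)) (fun j => (y j : ℝ)) =
    ((∑ i : Fin m, |partialSum x (i + 1) - partialSum y (i + 1)| : ℤ) : ℝ) := by
  unfold emd l1Dist
  push_cast
  simp only [partialSum_eq_prefixSum]

lemma eq_of_partialSum_eq {x y : Fin m → ℕ}
    (h : ∀ i : Fin m, partialSum x (i + 1) = partialSum y (i + 1)) : x = y := by
  have h' : ∀ t ≤ m, partialSum x t = partialSum y t := by
    rintro (_ | t) ht
    · rw [partialSum_zero, partialSum_zero]
    · exact h ⟨t, ht⟩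
  funext i
  have h1 := h i
  rw [partialSum_succ, partialSum_succ, h' i i.2.le] at h1
  exact_mod_cast add_left_cancel h1

end partialSum

lemma isGappedVecDist_emd : IsGappedVecDist @emd 2 where
  pos := by norm_num
  self x := isGappedVecDist_l1Dist.self _
  nonneg x y := isGappedVecDist_l1Dist.nonneg _ _
  triangle x y z := isGappedVecDist_l1Dist.triangle _ _ _
  gap x y h hxy := by
    have : ¬ ∀ i : Fin _, partialSum x (i + 1) = partialSum y (i + 1) :=
      fun h => hxy (eq_of_partialSum_eq h)
    push Not at this
    obtain ⟨i, hi⟩ := this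
    rw [emd_eq]
    have h1 : 1 ≤ |partialSum x (i + 1) - partialSum y (i + 1)| :=
      Int.one_le_abs (sub_ne_zero.2 hi)
    have h2 := Finset.single_le_sum
      (f := fun i : Fin _ => |partialSum x (i + 1) - partialSum y (i + 1)|)
      (fun i _ => abs_nonneg _) (Finset.mem_univ i)
    have h3 := h1.trans h2
    norm_num
    exact_mod_cast h3

lemma matDist_emd {C : Type} [Fintype C] {m : ℕ} (A B : C → Fin m → ℕ) :
    matDist @emd A B =
      ((∑ c, ∑ t : Fin m, |partialSum (A c) (t + 1) - partialSum (B c) (t + 1)| : ℤ) : ℝ) := by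
  simp only [matDist, emd_eq]
  push_cast
  rfl

lemma sum_ite_le_sub_ite_le {m : ℕ} (i j : Fin m) :
    ∑ t : Fin m, ((if (i : ℕ) < t + 1 then 1 else 0) - (if (j : ℕ) < t + 1 then 1 else 0) : ℤ) =
      j - i := by
  have : ∀ i : Fin m, ∑ t : Fin m, (if (i : ℕ) < t + 1 then 1 else 0 : ℤ) = m - i := by
    intro i
    have h : (Finset.univ.filter fun t : Fin m => (i : ℕ) < t + 1) = Finset.Ici i := by
      ext t
      simp only [Finset.mem_filter, Finset.mem_univ, true_and, Finset.mem_Ici, Fin.le_def]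
      omega
    rw [Finset.sum_boole, h, Fin.card_Ici, Nat.cast_sub i.2.le]
  rw [Finset.sum_sub_distrib, this, this]
  ring

section exchange

variable {C : Type} [DecidableEq C] {m n : ℕ} {A A' B : C → Fin m → ℕ} {a b : C}
  {i j : Fin m}

lemma IsExchange.partialSum_eq (h : IsExchange A A' a b i j) (c : C) (t : ℕ) :
    partialSum (A' c) t = partialSum (A c) t +
      ((if c = b then 1 else 0) - if c = a then 1 else 0) *
        ((if (i : ℕ) < t then 1 else 0) - if (j : ℕ) < t then 1 else 0) := by
  unfold partialSum
  simp only [h c, Finset.sum_add_distrib, ← Finset.mul_sum, Finset.sum_sub_distrib,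
    Finset.sum_ite_eq', Finset.mem_filter, Finset.mem_univ, true_and]

variable [Fintype C]

lemma IsExchange.matDist_emd_le (h : IsExchange A A' a b i j) (hij : i ≤ j) :
    matDist @emd A A' ≤ 2 * ((j : ℝ) - i) := by
  rw [matDist_emd]
  have : ∑ c, ∑ t : Fin m, |partialSum (A c) (t + 1) - partialSum (A' c) (t + 1)| ≤
      ∑ c, ∑ t : Fin m, (((if c = b then 1 else 0) + if c = a then 1 else 0) *
        ((if (i : ℕ) < t + 1 then 1 else 0) - if (j : ℕ) < t + 1 then 1 else 0) : ℤ) := by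
    refine Finset.sum_le_sum fun c _ => Finset.sum_le_sum fun t _ => ?_
    rw [h.partialSum_eq c, sub_add_cancel_left, abs_neg, abs_mul]
    rw [Fin.le_def] at hij
    refine mul_le_mul ?_ ?_ (abs_nonneg _) ?_ <;> split_ifs <;> first | omega | simp
  simp only [← Finset.mul_sum, ← Finset.sum_mul, sum_ite_le_sub_ite_le] at this
  simp only [Finset.sum_add_distrib, Finset.sum_ite_eq', Finset.mem_univ, if_true] at this
  norm_num at this
  exact_mod_cast this

/-- For `i < t ≤ j` the exchange lowers the prefix sum of row `a`, which is too large, and raises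
that of row `b`, which is too small. Each of these `j - i` prefixes gains 1 in both rows. -/
lemma IsExchange.matDist_emd_add_le (h : IsExchange A A' a b i j) (hab : a ≠ b) (hij : i ≤ j)
    (ha : ∀ t : ℕ, (i : ℕ) < t → t ≤ j → partialSum (B a) t < partialSum (A a) t)
    (hb : ∀ t : ℕ, (i : ℕ) < t → t ≤ j → partialSum (A b) t < partialSum (B b) t) :
    matDist @emd A' B + 2 * ((j : ℝ) - i) ≤ matDist @emd A B := by
  rw [matDist_emd, matDist_emd]
  have : ∑ c, ∑ t : Fin m, |partialSum (A' c) (t + 1) - partialSum (B c) (t + 1)| ≤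
      ∑ c, ∑ t : Fin m, (|partialSum (A c) (t + 1) - partialSum (B c) (t + 1)| -
        ((if c = b then 1 else 0) + if c = a then 1 else 0) *
        ((if (i : ℕ) < t + 1 then 1 else 0) - if (j : ℕ) < t + 1 then 1 else 0) : ℤ) := by
    refine Finset.sum_le_sum fun c _ => Finset.sum_le_sum fun t _ => ?_
    rw [h.partialSum_eq c, add_sub_right_comm]
    rw [Fin.le_def] at hij
    have key : ∀ x : ℤ, (x < 0 → |x + 1| ≤ |x| - 1) ∧ (0 < x → |x - 1| ≤ |x| - 1) := by
      intro x
      refine ⟨fun hx => ?_, fun hx => ?_⟩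
      · rw [abs_of_nonpos (by omega), abs_of_neg hx]
        omega
      · rw [abs_of_nonneg (by omega), abs_of_pos hx]
    by_cases hit : (i : ℕ) < t + 1
    · by_cases hjt : (j : ℕ) < t + 1
      · simp [hit, hjt]
      · have ha' := ha (t + 1) hit (by omega)
        have hb' := hb (t + 1) hit (by omega)
        by_cases hca : c = a
        · subst hca
          simpa [hit, hjt, hab, sub_eq_add_neg] using (key _).2 (sub_pos.2 ha')
        · by_cases hcb : c = b
          · subst hcb
            simpa [hit, hjt, hab.symm] using (key _).1 (sub_neg.2 hb')
          · simp [hca, hcb]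
    · have hjt : ¬ (j : ℕ) < t + 1 := by omega
      simp [hit, hjt]
  simp only [Finset.sum_sub_distrib, ← Finset.mul_sum, ← Finset.sum_mul] at this
  have h5 := sum_ite_le_sub_ite_le (i := i) (j := j)
  rw [Finset.sum_sub_distrib] at h5
  rw [h5] at this
  simp only [Finset.sum_add_distrib, Finset.sum_ite_eq', Finset.mem_univ, if_true] at this
  have h4 : (∑ c, ∑ t : Fin m, |partialSum (A' c) (t + 1) - partialSum (B c) (t + 1)|) +
      2 * ((j : ℤ) - i) ≤
        ∑ c, ∑ t : Fin m, |partialSum (A c) (t + 1) - partialSum (B c) (t + 1)| := by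
    linarith
  exact_mod_cast h4

/-- Column `s = i + 1` contains a unit of some row `d`, which serves as an intermediary. If `d` is
`a` or `b`, one adjacent exchange and one exchange of smaller width suffice. Otherwise `a` trades
places with `d`, then with `b`, and finally `d` with `b`; this restores row `d` and costs two
adjacent exchanges beyond the narrower one. -/
lemma exists_matWalk_isExchange (g : ℕ) : ∀ (A : C → Fin m → ℕ) (a b : C) (i j : Fin m),
    IsPositionMatrix n A → 1 ≤ A a i → 1 ≤ A b j → a ≠ b → (j : ℕ) = i + (g + 1) →
      ∃ (k : ℕ) (A' : C → Fin m → ℕ), k ≤ 2 * g + 1 ∧ MatWalk @emd 2 n k A A' ∧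
        IsExchange A A' a b i j := by
  have adj : ∀ (A : C → Fin m → ℕ) (a b : C) (i j : Fin m),
      IsPositionMatrix n A → 1 ≤ A a i → 1 ≤ A b j → a ≠ b → (j : ℕ) = i + 1 →
        ∃ A' : C → Fin m → ℕ, MatWalk @emd 2 n 1 A A' ∧ IsExchange A A' a b i j := by
    intro A a b i j hA hai hbj hab hij
    obtain ⟨A', h⟩ := exists_isExchange hai hbj hab (fun h => by simp [h] at hij)
    refine ⟨A', .step (h.isPositionMatrix hA) ?_ (.nil A'), h⟩
    have := h.matDist_emd_le (by rw [Fin.le_def]; omega)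
    rw [hij] at this
    push_cast at this
    linarith
  induction g with
  | zero =>
    intro A a b i j hA hai hbj hab hij
    obtain ⟨A', h1, h2⟩ := adj A a b i j hA hai hbj hab hij
    exact ⟨1, A', le_rfl, h1, h2⟩
  | succ g ih =>
    intro A a b i j hA hai hbj hab hij
    obtain ⟨s, hs⟩ : ∃ s : Fin m, (s : ℕ) = i + 1 := ⟨⟨i + 1, by omega⟩, rfl⟩
    have his : i ≠ s := fun h => by simp [← h] at hs
    have hjs : j ≠ s := fun h => by rw [h] at hij; omega
    have hij' : i ≠ j := fun h => by rw [h] at hij; omega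
    obtain ⟨d, hd⟩ : ∃ d, 1 ≤ A d s := by
      by_contra! hc
      have h0 : n = 0 := by
        rw [← hA.col s]
        exact Finset.sum_eq_zero fun c _ => Nat.lt_one_iff.1 (hc c)
      have := Finset.single_le_sum (fun c _ => Nat.zero_le (A c i)) (Finset.mem_univ a)
      rw [hA.col i] at this
      omega
    by_cases hda : d = a
    · subst hda
      obtain ⟨k, A₁, hk, w, e⟩ := ih A d b s j hA hd hbj hab (by omega)
      have e1 := e d i
      have e2 := e b s
      simp [his, hij', hab, hab.symm, hjs.symm] at e1 e2
      obtain ⟨A₂, w', e'⟩ := adj A₁ d b i s (w.isPositionMatrix hA) (by omega) (by omega) hab hs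
      refine ⟨k + 1, A₂, by omega, w.trans w', fun c t => ?_⟩
      rw [e' c t, e c t]
      ring
    by_cases hdb : d = b
    · subst hdb
      obtain ⟨A₁, w, e⟩ := adj A a d i s hA hai hd hab hs
      have e1 := e a s
      have e2 := e d j
      simp [his.symm, hij'.symm, hab, hab.symm, hjs] at e1 e2
      obtain ⟨k, A₂, hk, w', e'⟩ := ih A₁ a d s j (w.isPositionMatrix hA) (by omega) (by omega)
        hab (by omega)
      refine ⟨1 + k, A₂, by omega, w.trans w', fun c t => ?_⟩
      rw [e' c t, e c t]
      ring
    · obtain ⟨A₁, w, e⟩ := adj A a d i s hA hai hd (Ne.symm hda) hs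
      have e1 := e a s
      have e2 := e b j
      have e3 := e d i
      simp [his, his.symm, hij'.symm, hab.symm, hjs, Ne.symm hdb, Ne.symm hda, hda]
        at e1 e2 e3
      obtain ⟨k, A₂, hk, w', e'⟩ := ih A₁ a b s j (w.isPositionMatrix hA) (by omega) (by omega)
        hab (by omega)
      have e4 := e' d i
      have e5 := e' b s
      simp [his, hij', hab.symm, hjs.symm, hdb, hda] at e4 e5
      obtain ⟨A₃, w'', e''⟩ := adj A₂ d b i s (w'.isPositionMatrix (w.isPositionMatrix hA))
        (by omega) (by omega) hdb hs
      refine ⟨1 + k + 1, A₃, by omega, (w.trans w').trans w'', fun c t => ?_⟩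
      rw [e'' c t, e' c t, e c t]
      ring

end exchange

/-- At some prefix, row `a` has a surplus and row `b` a deficit. Moving left through columns where
row `a` of `A` is empty cannot reduce the surplus, and it vanishes at 0, so a unit of `a` is met.
Symmetrically, moving right from the deficit meets a unit of `b`, since total row sums agree. -/
lemma exists_crossing {C : Type} [Fintype C] {m n : ℕ} {A B : C → Fin m → ℕ}
    (hA : IsPositionMatrix n A) (hB : IsPositionMatrix n B) (hAB : A ≠ B) :
    ∃ (a b : C) (i j : Fin m), i < j ∧ 1 ≤ A a i ∧ 1 ≤ A b j ∧
      partialSum (B a) (i + 1) < partialSum (A a) (i + 1) ∧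
      partialSum (A b) j < partialSum (B b) j := by
  obtain ⟨c, hc⟩ := Function.ne_iff.1 hAB
  obtain ⟨t₀, ht₀⟩ : ∃ t : Fin m, partialSum (A c) (t + 1) ≠ partialSum (B c) (t + 1) := by
    by_contra! h
    exact hc (eq_of_partialSum_eq h)
  obtain ⟨t, ht, htm⟩ : ∃ t : ℕ, partialSum (A c) t ≠ partialSum (B c) t ∧ t ≤ m :=
    ⟨t₀ + 1, ht₀, t₀.2⟩
  have hsum : ∑ c, partialSum (A c) t = ∑ c, partialSum (B c) t :=
    (sum_partialSum hA t).trans (sum_partialSum hB t).symm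
  have hne : (fun c => partialSum (A c) t) ≠ fun c => partialSum (B c) t :=
    fun h => ht (congrFun h c)
  obtain ⟨a, ha⟩ := exists_lt_of_sum_eq hsum.symm hne.symm
  obtain ⟨b, hb⟩ := exists_lt_of_sum_eq hsum hne
  have left : ∀ t ≤ m, partialSum (B a) t < partialSum (A a) t → ∃ i : Fin m, (i : ℕ) < t ∧
      1 ≤ A a i ∧ partialSum (B a) (i + 1) < partialSum (A a) (i + 1) := by
    intro t
    induction t with
    | zero =>
      intro _ h
      rw [partialSum_zero, partialSum_zero] at h
      exact absurd h (lt_irrefl _)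
    | succ t ih =>
      intro htm h
      by_cases h1 : 1 ≤ A a ⟨t, htm⟩
      · exact ⟨⟨t, htm⟩, Nat.lt_succ_self t, h1, h⟩
      · have hA1 := partialSum_succ (A a) ⟨t, htm⟩
        have hB1 := partialSum_succ (B a) ⟨t, htm⟩
        dsimp only at hA1 hB1
        obtain ⟨i, hi, h2⟩ := ih (by omega) (by omega)
        exact ⟨i, by omega, h2⟩
  have right : ∀ s t, s + t = m → partialSum (A b) t < partialSum (B b) t →
      ∃ j : Fin m, t ≤ (j : ℕ) ∧ 1 ≤ A b j ∧ partialSum (A b) j < partialSum (B b) j := by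
    intro s
    induction s with
    | zero =>
      intro t ht h
      rw [zero_add] at ht
      subst ht
      have := (hA.row b).trans (hB.row b).symm
      zify at this
      rw [partialSum_self, partialSum_self, this] at h
      exact absurd h (lt_irrefl _)
    | succ s ih =>
      intro t ht h
      by_cases h1 : 1 ≤ A b ⟨t, by omega⟩
      · exact ⟨⟨t, by omega⟩, le_rfl, h1, h⟩
      · have hA1 := partialSum_succ (A b) ⟨t, by omega⟩
        have hB1 := partialSum_succ (B b) ⟨t, by omega⟩
        dsimp only at hA1 hB1
        obtain ⟨i, hi, h2⟩ := ih (t + 1) (by omega) (by omega)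
        exact ⟨i, by omega, h2⟩
  obtain ⟨i, hi, hi1, hi2⟩ := left t htm ha
  obtain ⟨j, hj, hj1, hj2⟩ := right (m - t) t (by omega) hb
  exact ⟨a, b, i, j, by rw [Fin.lt_def]; omega, hi1, hj1, hi2, hj2⟩

lemma exists_matWalk_emd {C : Type} [Fintype C] {m n : ℕ} {A B : C → Fin m → ℕ}
    (hA : IsPositionMatrix n A) (hB : IsPositionMatrix n B) (hAB : A ≠ B) :
    ∃ (k : ℕ) (A' : C → Fin m → ℕ), MatWalk @emd 2 n k A A' ∧
      k * 2 ≤ 2 * (matDist @emd A B - matDist @emd A' B) ∧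
        matDist @emd A' B + 1 ≤ matDist @emd A B := by
  classical
  let p : ℕ → Prop := fun g => ∃ (a b : C) (i j : Fin m), (j : ℕ) = i + (g + 1) ∧ 1 ≤ A a i ∧
    1 ≤ A b j ∧ partialSum (B a) (i + 1) < partialSum (A a) (i + 1) ∧
      partialSum (A b) j < partialSum (B b) j
  have hp : ∃ g, p g := by
    obtain ⟨a, b, i, j, hij, h⟩ := exists_crossing hA hB hAB
    rw [Fin.lt_def] at hij
    exact ⟨j - i - 1, a, b, i, j, by omega, h⟩
  -- A crossing of minimal width: this makes the prefix differences constant between its two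
  -- columns.
  obtain ⟨g, ⟨a, b, i, j, hij, hai, hbj, ha, hb⟩, hmin⟩ :
      ∃ g, p g ∧ ∀ g' < g, ¬ p g' := ⟨Nat.find hp, Nat.find_spec hp, fun _ h => Nat.find_min hp h⟩
  -- A unit of `d` in excess at `s` would give a narrower crossing: if the prefix of `d` before `s`
  -- is deficient, `d` replaces `b`; otherwise its prefix through `s` has a surplus and `d` replaces
  -- `a`.
  have hle : ∀ s : Fin m, (i : ℕ) < s → (s : ℕ) < j → ∀ d, A d s ≤ B d s := by
    intro s his hsj d
    by_contra! hc
    have hds : 1 ≤ A d s := by omega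
    have h1 : ¬ partialSum (A d) s < partialSum (B d) s := fun h =>
      hmin (s - i - 1) (by omega) ⟨a, d, i, s, by omega, hai, hds, ha, h⟩
    have h2 : ¬ partialSum (B d) (s + 1) < partialSum (A d) (s + 1) := fun h =>
      hmin (j - s - 1) (by omega) ⟨d, b, s, j, by omega, hds, hbj, h, hb⟩
    rw [partialSum_succ, partialSum_succ] at h2
    omega
  -- Equal column sums turn the entrywise inequality into equality.
  have heq : ∀ s : Fin m, (i : ℕ) < s → (s : ℕ) < j → ∀ d, A d s = B d s := fun s his hsj d =>
    (Finset.sum_eq_sum_iff_of_le fun d _ => hle s his hsj d).1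
      ((hA.col s).trans (hB.col s).symm) d (Finset.mem_univ d)
  have hconst : ∀ t : ℕ, (i : ℕ) < t → t ≤ j → ∀ d,
      partialSum (A d) t - partialSum (B d) t =
        partialSum (A d) (i + 1) - partialSum (B d) (i + 1) := by
    intro t hit
    induction t, hit using Nat.le_induction with
    | base => exact fun _ _ => rfl
    | succ t hit ih =>
      intro htj d
      have hA1 := partialSum_succ (A d) ⟨t, by omega⟩
      have hB1 := partialSum_succ (B d) ⟨t, by omega⟩
      have h1 := heq ⟨t, by omega⟩ hit htj d
      have h2 := ih (by omega) d
      dsimp only at hA1 hB1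
      omega
  have hj' := hconst j (by omega) le_rfl
  have hab : a ≠ b := by
    rintro rfl
    have := hj' a
    omega
  obtain ⟨k, A', hk, w, e⟩ := exists_matWalk_isExchange g A a b i j hA hai hbj hab hij
  have hij' : i ≤ j := by
    rw [Fin.le_def]
    omega
  have h1 := e.matDist_emd_add_le (B := B) hab hij'
    (fun t h1 h2 => by have := hconst t h1 h2 a; omega)
    (fun t h1 h2 => by have := hconst t h1 h2 b; have := hj' b; omega)
  rw [hij] at h1
  push_cast at h1
  have hk' : (k : ℝ) ≤ 2 * g + 1 := by exact_mod_cast hk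
  have hg : (0 : ℝ) ≤ g := g.cast_nonneg
  -- The cost is at most `2 * (2 * g + 1)`, and twice the gain is at least `4 * (g + 1)`.
  exact ⟨k, A', w, by linarith, by linarith⟩

lemma exists_walk_dPosEMD {m n : ℕ} (X Y : Election m n) :
    ∃ k : ℕ, k * 2 ≤ 2 * dPosEMD X Y ∧ Walk dPosEMD 2 k X Y :=
  isGappedVecDist_emd.exists_walk exists_matWalk_emd X Y

lemma isGapped_dPosEMD : IsGapped dPosEMD 2 := isGappedVecDist_emd.isGapped

theorem isAlphaIntrinsic_dPosEMD : IsAlphaIntrinsic 2 dPosEMD :=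
  isGapped_dPosEMD.isAlphaIntrinsic exists_walk_dPosEMD

/-! ### Lower bounds for positionwise metrics -/

section lower

variable {φ : VecDist} {δ : ℝ} {m n : ℕ}

lemma IsGappedVecDist.matDist_le_of_steps (hφ : IsGappedVecDist φ δ) {C : Type} [Fintype C]
    {A : ℕ → C → Fin m → ℕ} :
    ∀ {k : ℕ}, (∀ i < k, matDist φ (A i) (A (i + 1)) ≤ δ) → matDist φ (A 0) (A k) ≤ k * δ := by
  intro k
  induction k with
  | zero => simp [hφ.matDist_self]
  | succ k ih =>
    intro h
    have h1 := ih fun i hi => h i (hi.trans (Nat.lt_succ_self k))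
    have h2 := h k (Nat.lt_succ_self k)
    have h3 := hφ.matDist_triangle (A 0) (A k) (A (k + 1))
    push_cast
    linarith

/-- Composing the optimal matchings of consecutive elections labels all of them by the candidates of
`X`, so a chain of elections becomes a chain of matrices with a fixed row set. -/
lemma IsGappedVecDist.exists_steps (hφ : IsGappedVecDist φ δ)
    (hw : ∀ {m n : ℕ} (X Y : Election m n), ∃ k : ℕ, Walk (dPos φ) δ k X Y)
    {α : ℝ} (h : IsAlphaIntrinsic α (dPos φ)) {X Y : Election m n} (h0 : dPos φ X Y ≠ 0) :
    ∃ (k : ℕ) (A : ℕ → X.Cand → Fin m → ℕ) (σ : X.Cand ≃ Y.Cand),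
      k * δ ≤ α * dPos φ X Y ∧ (∀ i, IsPositionMatrix n (A i)) ∧ A 0 = X.position ∧
        (A k = fun c => Y.position (σ c)) ∧ ∀ i < k, matDist φ (A i) (A (i + 1)) ≤ δ := by
  obtain ⟨k, E, rfl, rfl, hsum, hE⟩ := h m n X Y h0
  have hδ : ∀ i < k, dPos φ (E i) (E (i + 1)) = δ := fun i hi =>
    hφ.isGapped.exists_eq hw h0 (hE i hi)
  choose σ hσ using fun i => exists_dPos_eq φ (E i) (E (i + 1))
  let τ : ∀ i : ℕ, (E 0).Cand ≃ (E i).Cand := fun i =>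
    Nat.rec (Equiv.refl _) (fun i τ => τ.trans (σ i)) i
  refine ⟨k, fun i c => (E i).position (τ i c), τ k, ?_,
    fun i => (E i).isPositionMatrix_position.reindex (τ i), rfl, rfl, fun i hi => ?_⟩
  · rw [Finset.sum_congr rfl fun i hi => hδ i (Finset.mem_range.1 hi), Finset.sum_const,
      Finset.card_range, nsmul_eq_mul] at hsum
    exact hsum
  · rw [← hδ i hi, ← hσ i]
    exact (matDist_reindex (τ i) (E i).position fun c => (E (i + 1)).position (σ i c)).le

/-- The election over the candidates `Fin m` with one vote `τ` and `N` identity votes. -/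
abbrev deviation (N : ℕ) (τ : Equiv.Perm (Fin m)) : Election m (N + 1) :=
  Election.ofVotes (Fintype.card_fin m) (Fin.cons τ fun _ => Equiv.refl (Fin m))

lemma position_deviation (N : ℕ) (τ : Equiv.Perm (Fin m)) (c j : Fin m) :
    (deviation N τ).position c j = (if τ c = j then 1 else 0) + if c = j then N else 0 := by
  rw [Election.position_eq_sum, Fin.sum_univ_succ]
  simp

lemma position_deviation_one (N : ℕ) (c j : Fin m) :
    (deviation N (Equiv.refl (Fin m))).position c j = if c = j then N + 1 else 0 := by
  rw [position_deviation]
  change (if c = j then 1 else 0) + (if c = j then N else 0) = _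
  split_ifs <;> omega

/-- The alternative `N ≤ k * δ` covers a nontrivial final matching: if `σ` moves `c`, the entry `(c,
c)` is `N + 1` on one side and at most 1 on the other. Replacing `α` by `max α 0` lets the upper
bound `D` stand in for the distance even when `α` is negative. -/
lemma IsGappedVecDist.exists_steps_deviation (hφ : IsGappedVecDist φ δ)
    (hcoord : ∀ {m : ℕ} (x y : Fin m → ℕ) (j : Fin m),
      |(x j : ℝ) - y j| ≤ φ (fun j => (x j : ℝ)) fun j => (y j : ℝ))
    (hw : ∀ {m n : ℕ} (X Y : Election m n), ∃ k : ℕ, Walk (dPos φ) δ k X Y)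
    {α : ℝ} (h : IsAlphaIntrinsic α (dPos φ)) {N : ℕ} (hN : 1 ≤ N) {τ : Equiv.Perm (Fin m)}
    {c₀ : Fin m} (hτ : τ c₀ ≠ c₀) {D : ℝ}
    (hD : matDist φ (deviation N (Equiv.refl (Fin m))).position (deviation N τ).position ≤ D) :
    ∃ k : ℕ, k * δ ≤ max α 0 * D ∧ ((N : ℝ) ≤ k * δ ∨ ∃ A : ℕ → Fin m → Fin m → ℕ,
      (∀ i, IsPositionMatrix (N + 1) (A i)) ∧
        A 0 = (deviation N (Equiv.refl (Fin m))).position ∧ A k = (deviation N τ).position ∧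
          ∀ i < k, matDist φ (A i) (A (i + 1)) ≤ δ) := by
  set X := deviation N (Equiv.refl (Fin m))
  set Y := deviation N τ
  have hentry : ∀ (σ : X.Cand ≃ Y.Cand) (c j : Fin m), |(X.position c j : ℝ) - Y.position (σ c) j| ≤
      matDist φ X.position fun c => Y.position (σ c) := fun σ c j =>
    (hcoord _ _ j).trans (Finset.single_le_sum
      (f := fun c => φ (fun j => (X.position c j : ℝ)) (fun j => (Y.position (σ c) j : ℝ)))
      (fun c _ => hφ.nonneg _ _) (Finset.mem_univ c))
  have h0 : dPos φ X Y ≠ 0 := by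
    obtain ⟨σ, hσ⟩ := exists_dPos_eq φ X Y
    intro h
    have h1 := hentry σ (σ.symm c₀) (σ.symm c₀)
    rw [hσ, h, σ.apply_symm_apply] at h1
    have h2 : X.position (σ.symm c₀) (σ.symm c₀) = Y.position c₀ (σ.symm c₀) := by
      have := abs_nonpos_iff.1 h1
      exact_mod_cast sub_eq_zero.1 this
    rw [position_deviation_one, position_deviation] at h2
    generalize (σ.symm c₀ : Fin m) = x at h2
    rw [if_pos rfl] at h2
    split_ifs at h2 with h3 h4
    · exact hτ (h3.trans h4.symm)
    all_goals omega
  have hDle : dPos φ X Y ≤ D := (dPos_le X Y (Equiv.refl (Fin m))).trans hD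
  have hD0 := hφ.isGapped.nonneg X Y
  obtain ⟨k, A, σ, hk, hA, hA0, hAk, hs⟩ := hφ.exists_steps hw h h0
  refine ⟨k, hk.trans ((mul_le_mul_of_nonneg_right (le_max_left α 0) hD0).trans
    (mul_le_mul_of_nonneg_left hDle (le_max_right α 0))), ?_⟩
  by_cases hσ : ∀ c : Fin m, (σ c : Fin m) = c
  · right
    refine ⟨A, hA, hA0, hAk.trans (funext fun c => ?_), hs⟩
    exact congrArg Y.position (hσ c)
  · left
    push Not at hσ
    obtain ⟨c, hc⟩ := hσ
    refine le_trans ?_ (hφ.matDist_le_of_steps hs)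
    rw [hA0, hAk]
    refine le_trans ?_ (hentry σ c c)
    have h1 : X.position c c = N + 1 := (position_deviation_one N c c).trans (if_pos rfl)
    have h2 : Y.position (σ c) c ≤ 1 := by
      refine (position_deviation N τ (σ c) c).le.trans ?_
      rw [if_neg hc]
      split_ifs <;> simp
    have h3 : (Y.position (σ c) c : ℝ) ≤ 1 := by exact_mod_cast h2
    rw [h1]
    push_cast
    exact le_trans (by linarith) (le_abs_self _)

end lower

/-! ### The `ℓ₁`-positionwise metric -/

lemma abs_sub_le_l1Dist {m : ℕ} (x y : Fin m → ℝ) (j : Fin m) : |x j - y j| ≤ l1Dist x y :=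
  Finset.single_le_sum (f := fun j => |x j - y j|) (fun _ _ => abs_nonneg _) (Finset.mem_univ j)

/-- Each changed row costs at least 2, so at most two rows change, and fixed column sums make their
changes opposite. Thus `B - A` has rank at most one. -/
lemma exists_row_of_matDist_l1Dist_le {C : Type} [Fintype C] {m n : ℕ} {A B : C → Fin m → ℕ}
    (hA : IsPositionMatrix n A) (hB : IsPositionMatrix n B) (h : matDist @l1Dist A B ≤ 4) :
    ∃ r : Fin m → ℝ, ∀ c, ∃ s : ℝ, ∀ t, (B c t : ℝ) - A c t = s * r t := by
  classical
  by_cases hAB : A = B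
  · exact ⟨0, fun c => ⟨0, by simp [hAB]⟩⟩
  obtain ⟨a, ha⟩ := Function.ne_iff.1 hAB
  refine ⟨fun t => (B a t : ℝ) - A a t, fun c => ?_⟩
  by_cases hca : c = a
  · exact ⟨1, by simp [hca]⟩
  by_cases hc : A c = B c
  · exact ⟨0, by simp [hc]⟩
  refine ⟨-1, fun t => ?_⟩
  have hrest : ∀ d, d ≠ a → d ≠ c → A d = B d := by
    intro d hda hdc
    by_contra hd
    have hrow : ∀ c, A c ≠ B c → 2 ≤ l1Dist (fun j => (A c j : ℝ)) fun j => (B c j : ℝ) :=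
      fun c hc => le_trans (by norm_num)
        (isGappedVecDist_l1Dist.gap _ _ ((hA.row c).trans (hB.row c).symm) hc)
    have h3 : ∑ c ∈ {d, a, c}, l1Dist (fun j => (A c j : ℝ)) (fun j => (B c j : ℝ)) ≤
        matDist @l1Dist A B :=
      Finset.sum_le_sum_of_subset_of_nonneg (Finset.subset_univ _)
        fun _ _ _ => isGappedVecDist_l1Dist.nonneg _ _
    rw [Finset.sum_insert (by simp [hda, hdc]), Finset.sum_pair (Ne.symm hca)] at h3
    linarith [hrow a ha, hrow c hc, hrow d hd]
  have h1 : ∑ d, ((B d t : ℝ) - A d t) = 0 := by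
    rw [Finset.sum_sub_distrib, sub_eq_zero]
    exact_mod_cast (hB.col t).trans (hA.col t).symm
  have h2 : ∑ d ∈ {a, c}, ((B d t : ℝ) - A d t) = ∑ d, ((B d t : ℝ) - A d t) := by
    refine Finset.sum_subset (Finset.subset_univ _) fun d _ hd => ?_
    simp only [Finset.mem_insert, Finset.mem_singleton, not_or] at hd
    rw [hrest d hd.1 hd.2, sub_self]
  rw [Finset.sum_pair (Ne.symm hca), h1] at h2
  linarith

lemma exists_orthogonal {m k : ℕ} (h : k + 1 < m) (r : Fin k → Fin m → ℝ) (j : Fin m) :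
    ∃ v : Fin m → ℝ, v ≠ 0 ∧ v j = 0 ∧ ∀ i, ∑ t, r i t * v t = 0 := by
  let M : Matrix (Fin (k + 1)) (Fin m) ℝ := Matrix.of (Fin.cons (Pi.single j 1) r)
  have hker : LinearMap.ker M.mulVecLin ≠ ⊥ :=
    LinearMap.ker_ne_bot_of_finrank_lt (by simpa using h)
  obtain ⟨v, hv, hv0⟩ := Submodule.exists_mem_ne_zero_of_ne_bot hker
  have hv' : M.mulVec v = 0 := hv
  refine ⟨v, hv0, ?_, fun i => ?_⟩
  · simpa [M, Matrix.mulVec, dotProduct, Pi.single_apply] using congrFun hv' 0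
  · simpa [M, Matrix.mulVec, dotProduct] using congrFun hv' i.succ

lemma le_of_steps_l1Dist {m N k : ℕ} {A : ℕ → Fin (m + 1) → Fin (m + 1) → ℕ}
    (hA : ∀ i, IsPositionMatrix (N + 1) (A i))
    (h0 : A 0 = (deviation N (Equiv.refl (Fin (m + 1)))).position)
    (hk : A k = (deviation N (finRotate (m + 1))).position)
    (hs : ∀ i < k, matDist @l1Dist (A i) (A (i + 1)) ≤ 4) : m ≤ k := by
  by_contra! hkm
  have hrow : ∀ i : Fin k, ∃ r : Fin (m + 1) → ℝ, ∀ c, ∃ s : ℝ, ∀ t,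
      (A (i + 1) c t : ℝ) - A i c t = s * r t := fun i =>
    exists_row_of_matDist_l1Dist_le (hA i) (hA (i + 1)) (hs i i.2)
  choose r hr using hrow
  -- Fewer than `m` rank-one changes, plus the normalization `v 0 = 0`, leave a nonzero `v` in
  -- dimension `m + 1`. Pairing rows with `v` is invariant along the chain, and the rotation then
  -- forces `v` to be constant, hence zero.
  obtain ⟨v, hv, hv0, hrv⟩ := exists_orthogonal (Nat.succ_lt_succ hkm) r 0
  have hinv : ∀ i ≤ k, ∀ c, ∑ t, (A i c t : ℝ) * v t = ∑ t, (A 0 c t : ℝ) * v t := by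
    intro i
    induction i with
    | zero => exact fun _ _ => rfl
    | succ i ih =>
      intro hi c
      rw [← ih (Nat.le_of_succ_le hi) c, ← sub_eq_zero, ← Finset.sum_sub_distrib]
      obtain ⟨s, hs'⟩ := hr ⟨i, hi⟩ c
      have h1 : ∀ t, (A (i + 1) c t : ℝ) * v t - A i c t * v t = s * (r ⟨i, hi⟩ t * v t) := by
        intro t
        rw [← sub_mul, hs' t, mul_assoc]
      simp only [h1]
      rw [← Finset.mul_sum, hrv, mul_zero]
  have hrot : ∀ c, v (c + 1) = v c := by
    intro c
    have h1 := hinv k le_rfl c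
    rw [h0, hk] at h1
    simp only [position_deviation, finRotate_apply] at h1
    push_cast at h1
    simp only [add_mul, ite_mul, one_mul, zero_mul, Finset.sum_add_distrib, Finset.sum_ite_eq,
      Finset.mem_univ, if_true] at h1
    change _ = v c + (N : ℝ) * v c at h1
    linarith
  apply hv
  funext c
  induction c using Fin.induction with
  | zero => exact hv0
  | succ i ih => rw [← Fin.coeSucc_eq_succ, hrot]; exact ih

lemma matDist_l1Dist_deviation_le {m : ℕ} (N : ℕ) (τ : Equiv.Perm (Fin m)) :
    matDist @l1Dist (deviation N (Equiv.refl (Fin m))).position (deviation N τ).position ≤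
      2 * m := by
  have : ∀ c : Fin m, l1Dist
      (fun j => ((deviation N (Equiv.refl (Fin m))).position c j : ℝ))
      (fun j => ((deviation N τ).position c j : ℝ)) ≤ 2 := by
    intro c
    have h : ∀ j, |((deviation N (Equiv.refl (Fin m))).position c j : ℝ) -
        (deviation N τ).position c j| ≤ (if c = j then 1 else 0) + if τ c = j then 1 else 0 := by
      intro j
      rw [position_deviation_one, position_deviation]
      push_cast
      split_ifs <;> rw [abs_le] <;> constructor <;> linarith
    refine (Finset.sum_le_sum fun j _ => h j).trans (le_of_eq ?_)
    rw [Finset.sum_add_distrib, Finset.sum_ite_eq, Finset.sum_ite_eq]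
    norm_num
  refine (Finset.sum_le_sum fun c _ => this c).trans (le_of_eq ?_)
  simp [mul_comm]

theorem not_isAlphaIntrinsic_dPosL1 {α : ℝ} (hα : α < 2) : ¬ IsAlphaIntrinsic α dPosL1 := by
  intro h
  have hβ : max α 0 < 2 := max_lt hα two_pos
  have hβ0 := le_max_right α 0
  -- With `β = max α 0`, the bounds `m ≤ k` and `4 * k ≤ β * (2 * (m + 1))` conflict once `m * (4 -
  -- 2 * β) > 2 * β`.
  obtain ⟨m, hm⟩ := exists_nat_gt ((2 * max α 0) / (4 - 2 * max α 0))
  rw [div_lt_iff₀ (by linarith)] at hm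
  have hm1 : 1 ≤ m := by
    rcases Nat.eq_zero_or_pos m with rfl | h
    · norm_num at hm
      linarith
    · exact h
  have hrot : finRotate (m + 1) 0 ≠ 0 := by
    obtain ⟨m, rfl⟩ := Nat.exists_eq_add_of_le' hm1
    simp
  -- With `N = 4 * m`, a nontrivial final matching also gives `m ≤ k`.
  obtain ⟨k, hk, h2⟩ := isGappedVecDist_l1Dist.exists_steps_deviation
    (fun x y j => abs_sub_le_l1Dist (fun j => (x j : ℝ)) (fun j => (y j : ℝ)) j)
    (fun X Y => (exists_walk_dPosL1 X Y).imp fun _ h => h.2) h (N := 4 * m) (by omega) hrot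
    (matDist_l1Dist_deviation_le (4 * m) (finRotate (m + 1)))
  have hkm : (m : ℝ) ≤ k := by
    rcases h2 with h2 | ⟨A, hA, h0, hAk, hs⟩
    · push_cast at h2
      linarith
    · exact_mod_cast le_of_steps_l1Dist hA h0 hAk hs
  push_cast at hk
  nlinarith

/-! ### The EMD-positionwise metric -/

lemma abs_sub_le_emd {m : ℕ} (x y : Fin m → ℕ) (j : Fin m) :
    |(x j : ℝ) - y j| ≤ emd (fun j => (x j : ℝ)) fun j => (y j : ℝ) := by
  rw [emd_eq]
  have hsum := fun s : Finset (Fin m) => Finset.sum_le_sum_of_subset_of_nonneg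
    (f := fun i : Fin m => |partialSum x (i + 1) - partialSum y (i + 1)|)
    (Finset.subset_univ s) fun _ _ _ => abs_nonneg _
  have key : |(x j : ℤ) - y j| ≤ ∑ i : Fin m, |partialSum x (i + 1) - partialSum y (i + 1)| := by
    have h1 : (x j : ℤ) - y j = (partialSum x (j + 1) - partialSum y (j + 1)) -
        (partialSum x j - partialSum y j) := by
      rw [partialSum_succ, partialSum_succ]
      ring
    rw [h1]
    refine (abs_sub _ _).trans ?_
    rcases j with ⟨_ | t, ht⟩
    · have := hsum {⟨0, ht⟩}
      simpa [partialSum_zero] using this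
    · have := hsum {⟨t + 1, ht⟩, ⟨t, by omega⟩}
      rw [Finset.sum_pair (by simp)] at this
      exact this
  exact_mod_cast key

/-- Sums of prefix sums over all rows are fixed, so the other rows together move at least as much as
row `a`. In particular, a step of length 2 moves any row by at most 1. -/
lemma two_mul_emd_le_matDist {C : Type} [Fintype C] {m n : ℕ} {A B : C → Fin m → ℕ}
    (hA : IsPositionMatrix n A) (hB : IsPositionMatrix n B) (a : C) :
    2 * emd (fun j => (A a j : ℝ)) (fun j => (B a j : ℝ)) ≤ matDist @emd A B := by
  classical
  rw [emd_eq, matDist_emd]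
  have key : ∑ t : Fin m, |partialSum (A a) (t + 1) - partialSum (B a) (t + 1)| ≤
      ∑ c ∈ Finset.univ.erase a, ∑ t : Fin m,
        |partialSum (A c) (t + 1) - partialSum (B c) (t + 1)| := by
    rw [Finset.sum_comm]
    refine Finset.sum_le_sum fun t _ => ?_
    have h1 : ∑ c, (partialSum (A c) (t + 1) - partialSum (B c) (t + 1)) = 0 := by
      rw [Finset.sum_sub_distrib, sum_partialSum hA, sum_partialSum hB, sub_self]
    rw [← Finset.add_sum_erase _ _ (Finset.mem_univ a), add_eq_zero_iff_eq_neg] at h1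
    rw [h1, abs_neg]
    exact Finset.abs_sum_le_sum_abs _ _
  rw [← Finset.add_sum_erase _ _ (Finset.mem_univ a)]
  push_cast
  have key' : ∑ t : Fin m, |(partialSum (A a) (t + 1) : ℝ) - partialSum (B a) (t + 1)| ≤
      ∑ c ∈ Finset.univ.erase a, ∑ t : Fin m,
        |(partialSum (A c) (t + 1) : ℝ) - partialSum (B c) (t + 1)| := by
    exact_mod_cast key
  linarith

lemma isExchange_deviation {l : ℕ} (N : ℕ) (hl : 1 ≤ l) :
    IsExchange (deviation N (Equiv.refl (Fin (l + 1)))).position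
      (deviation N (Equiv.swap 0 (Fin.last l))).position 0 (Fin.last l) 0 (Fin.last l) := by
  intro c t
  have hne : (0 : Fin (l + 1)) ≠ Fin.last l := by
    intro h
    have := congrArg Fin.val h
    simp at this
    omega
  rw [position_deviation_one, position_deviation]
  by_cases h0 : c = 0
  · subst h0
    rw [Equiv.swap_apply_left]
    simp only [hne, eq_comm (a := t)]
    split_ifs <;> push_cast <;> first | omega | (exfalso; apply hne; simp_all)
  by_cases h1 : c = Fin.last l
  · subst h1
    rw [Equiv.swap_apply_right]
    simp only [hne.symm, eq_comm (a := t)]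
    split_ifs <;> push_cast <;> first | omega | (exfalso; apply hne; simp_all)
  · rw [Equiv.swap_apply_of_ne_of_ne h0 h1]
    simp only [h0, h1]
    split_ifs <;> push_cast <;> omega

section moves

variable {l N k : ℕ} {A : ℕ → Fin (l + 1) → Fin (l + 1) → ℕ}

lemma emd_le_sum_Ico {m : ℕ} (x : ℕ → Fin m → ℝ) {i j : ℕ} (hij : i ≤ j) :
    emd (x i) (x j) ≤ ∑ s ∈ Finset.Ico i j, emd (x s) (x (s + 1)) := by
  induction j, hij using Nat.le_induction with
  | base => simp [isGappedVecDist_emd.self]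
  | succ j hij ih =>
    rw [Finset.sum_Ico_succ_top hij]
    have := isGappedVecDist_emd.triangle (x i) (x j) (x (j + 1))
    linarith

/-- If row `d` never changed, it would fill column `d` entirely, so row 0 would have equal prefix
sums before and after that column. When its unit crosses, both prefixes change in the same step,
costing row 0 at least 2 where only 1 is available. -/
lemma exists_row_ne (hA : ∀ i, IsPositionMatrix (N + 1) (A i))
    (h0 : A 0 = (deviation N (Equiv.refl (Fin (l + 1)))).position)
    (hk : A k = (deviation N (Equiv.swap 0 (Fin.last l))).position)
    (hs : ∀ i < k, matDist @emd (A i) (A (i + 1)) ≤ 2) {d : Fin (l + 1)} (hd0 : 0 < (d : ℕ))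
    (hdl : (d : ℕ) < l) : ∃ s ≤ k, A s d ≠ A 0 d := by
  by_contra! hc
  have hne : (0 : Fin (l + 1)) ≠ d := by
    intro h
    rw [← h] at hd0
    simp at hd0
  have hcol : ∀ s ≤ k, partialSum (A s 0) (d + 1) = partialSum (A s 0) d := by
    intro s hs
    have h1 := (hA s).col d
    have h2 : A s d d = N + 1 := by rw [hc s hs, h0, position_deviation_one, if_pos rfl]
    have h3 : ∑ c ∈ {0, d}, A s c d ≤ ∑ c, A s c d :=
      Finset.sum_le_sum_of_subset (Finset.subset_univ _)
    rw [Finset.sum_pair hne, h1, h2] at h3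
    have h4 := partialSum_succ (A s 0) d
    omega
  obtain ⟨s, hsk, hsd⟩ : ∃ s < k, partialSum (A s 0) d ≠ partialSum (A (s + 1) 0) d := by
    by_contra! hc'
    have hconst : ∀ s ≤ k, partialSum (A s 0) d = partialSum (A 0 0) d := by
      intro s
      induction s with
      | zero => exact fun _ => rfl
      | succ s ih => exact fun hs => (hc' s hs).symm.trans (ih (Nat.le_of_succ_le hs))
    have h1 := (isExchange_deviation (l := l) N (by omega)).partialSum_eq 0 d
    have h2 : (0 : Fin (l + 1)) ≠ Fin.last l := by
      intro h
      have := congrArg Fin.val h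
      simp at this
      omega
    have h3 : ¬ l < d := by omega
    rw [← hk, ← h0, hconst k le_rfl] at h1
    simp [h2, hd0, h3] at h1
  have h1 := two_mul_emd_le_matDist (hA s) (hA (s + 1)) 0
  have h2 := hs s hsk
  rw [emd_eq] at h1
  have h3 : (∑ t : Fin (l + 1), |partialSum (A s 0) (t + 1) - partialSum (A (s + 1) 0) (t + 1)|)
      ≤ 1 := by
    have h4 := h1.trans h2
    have : 2 * (∑ t : Fin (l + 1),
        |partialSum (A s 0) (t + 1) - partialSum (A (s + 1) 0) (t + 1)|) ≤ 2 := by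
      exact_mod_cast h4
    omega
  obtain ⟨e, he⟩ : ∃ e : Fin (l + 1), (e : ℕ) + 1 = d := ⟨⟨d - 1, by omega⟩, by simp; omega⟩
  have h5 := Finset.sum_le_sum_of_subset_of_nonneg
    (f := fun t : Fin (l + 1) =>
      |partialSum (A s 0) (t + 1) - partialSum (A (s + 1) 0) (t + 1)|)
    (Finset.subset_univ {e, d}) fun _ _ _ => abs_nonneg _
  rw [Finset.sum_pair (fun h => by rw [h] at he; omega), he, hcol s hsk.le, hcol (s + 1) hsk] at h5
  have h6 := Int.one_le_abs (sub_ne_zero.2 hsd)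
  omega

lemma le_of_steps_emd {l N k : ℕ} {A : ℕ → Fin (l + 2) → Fin (l + 2) → ℕ}
    (hA : ∀ i, IsPositionMatrix (N + 1) (A i))
    (h0 : A 0 = (deviation N (Equiv.refl (Fin (l + 2)))).position)
    (hk : A k = (deviation N (Equiv.swap 0 (Fin.last (l + 1)))).position)
    (hs : ∀ i < k, matDist @emd (A i) (A (i + 1)) ≤ 2) : 2 * l + 1 ≤ k := by
  let x : Fin (l + 2) → ℕ → Fin (l + 2) → ℝ := fun c i j => (A i c j : ℝ)
  have htotal : ∑ c, ∑ i ∈ Finset.range k, emd (x c i) (x c (i + 1)) ≤ k * 2 := by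
    rw [Finset.sum_comm]
    refine (Finset.sum_le_sum fun i hi => hs i (Finset.mem_range.1 hi)).trans (le_of_eq ?_)
    simp
  have hends : ∀ c : Fin (l + 2), c = 0 ∨ c = Fin.last (l + 1) →
      (l : ℝ) + 1 ≤ ∑ i ∈ Finset.range k, emd (x c i) (x c (i + 1)) := by
    intro c hc
    rw [Finset.range_eq_Ico]
    refine le_trans (le_of_eq ?_) (emd_le_sum_Ico (x c) (Nat.zero_le k))
    have hex := isExchange_deviation (l := l + 1) N (by omega)
    rw [← h0, ← hk] at hex
    have hsum := sum_ite_le_sub_ite_le (i := (0 : Fin (l + 2))) (j := Fin.last (l + 1))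
    simp only [x]
    rw [emd_eq]
    have hne : (0 : Fin (l + 2)) ≠ Fin.last (l + 1) := by simp [Fin.ext_iff]
    have : ∑ t : Fin (l + 2), |partialSum (A 0 c) (t + 1) - partialSum (A k c) (t + 1)| =
        l + 1 := by
      have h1 : ((Fin.last (l + 1) : ℕ) : ℤ) - ((0 : Fin (l + 2)) : ℕ) = l + 1 := by simp
      rw [← h1, ← hsum]
      refine Finset.sum_congr rfl fun t _ => ?_
      have h2 : (0 : ℤ) ≤ (if ((0 : Fin (l + 2)) : ℕ) < t + 1 then 1 else 0) -
          (if ((Fin.last (l + 1) : Fin (l + 2)) : ℕ) < t + 1 then 1 else 0) := by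
        simp
        split_ifs <;> simp
      rw [hex.partialSum_eq c, sub_add_cancel_left, abs_neg, abs_mul, abs_of_nonneg h2]
      rcases hc with rfl | rfl
      · simp [hne]
      · simp [hne.symm]
    rw [this]
    push_cast
    rfl
  have hmid : ∀ c : Fin l, (2 : ℝ) ≤
      ∑ i ∈ Finset.range k, emd (x c.castSucc.succ i) (x c.castSucc.succ (i + 1)) := by
    intro c
    obtain ⟨s, hsk, hne⟩ := exists_row_ne hA h0 hk hs (d := c.castSucc.succ) (by simp)
      (by simp)
    have hex := isExchange_deviation (l := l + 1) N (by omega)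
    rw [← h0, ← hk] at hex
    have hAk : A k c.castSucc.succ = A 0 c.castSucc.succ := by
      funext t
      have h1 : c.castSucc.succ ≠ 0 := Fin.succ_ne_zero _
      have h2 : c.castSucc.succ ≠ Fin.last (l + 1) := by
        simp [Fin.ext_iff]
        omega
      have := hex c.castSucc.succ t
      simp only [h1, h2, if_false, sub_self, zero_mul, add_zero] at this
      exact_mod_cast this
    have hrow := fun i => (hA i).row c.castSucc.succ
    have g1 := isGappedVecDist_emd.gap _ _ ((hrow 0).trans (hrow s).symm) hne.symm
    have g2 := isGappedVecDist_emd.gap _ _ ((hrow s).trans (hrow k).symm) (hAk ▸ hne)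
    have t1 := emd_le_sum_Ico (x c.castSucc.succ) (Nat.zero_le s)
    have t2 := emd_le_sum_Ico (x c.castSucc.succ) hsk
    rw [Finset.range_eq_Ico, ← Finset.sum_Ico_consecutive _ (Nat.zero_le s) hsk]
    simp only [x] at t1 t2 ⊢
    linarith
  -- The first and last rows travel at least `l + 1` each, and each of the `l` middle rows at least
  -- 2 for leaving and returning, so `4 * l + 2 ≤ 2 * k`.
  rw [Fin.sum_univ_succ, Fin.sum_univ_castSucc] at htotal
  have hm := Finset.sum_le_sum fun (c : Fin l) (_ : c ∈ Finset.univ) => hmid c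
  simp only [Finset.sum_const, Finset.card_univ, Fintype.card_fin, nsmul_eq_mul] at hm
  have e1 := hends 0 (Or.inl rfl)
  have e2 := hends (Fin.last (l + 1)) (Or.inr rfl)
  rw [Fin.succ_last] at htotal
  have : (2 * l + 1 : ℝ) ≤ k := by linarith
  exact_mod_cast this

end moves

theorem not_isAlphaIntrinsic_dPosEMD {α : ℝ} (hα : α < 2) : ¬ IsAlphaIntrinsic α dPosEMD := by
  intro h
  have hβ : max α 0 < 2 := max_lt hα two_pos
  have hβ0 := le_max_right α 0
  -- With `β = max α 0`, this contradicts `2 * (2 * l + 1) ≤ 2 * k ≤ β * (2 * (l + 1))`.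
  obtain ⟨l, hl⟩ := exists_nat_gt ((max α 0) / (2 - max α 0))
  rw [div_lt_iff₀ (by linarith)] at hl
  have hrot : Equiv.swap 0 (Fin.last (l + 1)) 0 ≠ 0 := by
    rw [Equiv.swap_apply_left]
    simp [Fin.ext_iff]
  have hD := (isExchange_deviation (l := l + 1) (4 * l + 2) (by omega)).matDist_emd_le
    (Fin.zero_le _)
  obtain ⟨k, hk, h2⟩ := isGappedVecDist_emd.exists_steps_deviation
    (fun x y j => abs_sub_le_emd x y j)
    (fun X Y => (exists_walk_dPosEMD X Y).imp fun _ h => h.2) h (by omega) hrot hD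
  have hkm : (2 * l + 1 : ℝ) ≤ k := by
    rcases h2 with h2 | ⟨A, hA, h0, hAk, hs⟩
    · push_cast at h2
      linarith
    · exact_mod_cast le_of_steps_emd hA h0 hAk hs
  simp only [Fin.val_last, Fin.val_zero] at hk
  push_cast at hk
  nlinarith

/-! ### The Bordawise metric -/

lemma Election.sum_borda {m n : ℕ} (X : Election m n) :
    ∑ c, X.borda c = n * ∑ j : Fin m, (m - ((j : ℕ) + 1)) := by
  unfold Election.borda
  rw [Finset.sum_comm, Finset.sum_congr rfl fun i _ =>
    Equiv.sum_comp (X.vote i) fun j : Fin m => m - ((j : ℕ) + 1)]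
  simp

lemma Election.exists_sortedBorda {m n : ℕ} (X : Election m n) :
    ∃ L : List ℕ, L.length = m ∧ L.Pairwise (· ≥ ·) ∧ (∀ y, y ∈ L ↔ ∃ c, X.borda c = y) ∧
      L.sum = n * ∑ j : Fin m, (m - ((j : ℕ) + 1)) ∧
        ∀ j : Fin m, X.sortedBorda j = L.getD j 0 := by
  refine ⟨(Finset.univ.val.map X.borda).sort (· ≥ ·), ?_, Multiset.pairwise_sort _ _, ?_, ?_,
    fun _ => rfl⟩
  · rw [Multiset.length_sort, Multiset.card_map]
    exact X.card_cand
  · simp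
  · rw [← X.sum_borda, ← Multiset.sum_coe, Multiset.sort_eq]
    rfl

lemma emd_three (x y : Fin 3 → ℕ) : emd (fun j => (x j : ℝ)) (fun j => (y j : ℝ)) =
    ((|(x 0 : ℤ) - y 0| + |(x 0 + x 1 : ℤ) - (y 0 + y 1)| +
      |(x 0 + x 1 + x 2 : ℤ) - (y 0 + y 1 + y 2)| : ℤ) : ℝ) := by
  rw [emd_eq, Fin.sum_univ_three]
  simp [partialSum, Finset.sum_filter, Fin.sum_univ_three]

lemma emd_two (x y : Fin 2 → ℕ) : emd (fun j => (x j : ℝ)) (fun j => (y j : ℝ)) =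
    ((|(x 0 : ℤ) - y 0| + |(x 0 + x 1 : ℤ) - (y 0 + y 1)| : ℤ) : ℝ) := by
  rw [emd_eq, Fin.sum_univ_two]
  simp [partialSum, Finset.sum_filter]

/-- The sorted Borda vectors are `(2, 0)` and `(1, 1)`. -/
lemma dBorda_deviation_two : dBorda (deviation 1 (Equiv.refl (Fin 2)))
    (deviation 1 (Equiv.swap (0 : Fin 2) 1)) = 1 := by
  obtain ⟨L, hL, hp, hmem, hsum, hj⟩ := (deviation 1 (Equiv.refl (Fin 2))).exists_sortedBorda
  obtain ⟨L', hL', hp', hmem', hsum', hj'⟩ :=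
    (deviation 1 (Equiv.swap (0 : Fin 2) 1)).exists_sortedBorda
  obtain ⟨a, b, rfl⟩ := List.length_eq_two.1 hL
  obtain ⟨a', b', rfl⟩ := List.length_eq_two.1 hL'
  unfold dBorda
  rw [emd_two]
  have h1 : (deviation 1 (Equiv.refl (Fin 2))).borda (0 : Fin 2) = 2 := by decide
  have h2 : ∀ c : Fin 2, (deviation 1 (Equiv.swap (0 : Fin 2) 1)).borda c = 1 := by decide
  have h3 := (hmem 2).2 ⟨_, h1⟩
  obtain ⟨c, hc⟩ := (hmem' a').1 (by simp)
  rw [h2 c] at hc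
  obtain ⟨d, hd⟩ := (hmem' b').1 (by simp)
  rw [h2 d] at hd
  simp [Fin.sum_univ_two] at h3 hp hsum
  rw [hj, hj, hj', hj', ← hc, ← hd]
  obtain ⟨rfl, rfl⟩ : a = 2 ∧ b = 0 := by omega
  simp

theorem not_isIntrinsic_dBorda : ¬ IsIntrinsic dBorda := by
  intro h
  let rev : Equiv.Perm (Fin 3) := Equiv.swap 0 2
  let X : Election 3 2 := deviation 1 rev
  let Y : Election 3 2 := deviation 1 (Equiv.refl _)
  have hX : ∀ j, X.sortedBorda j = 2 := by
    obtain ⟨L, hL, -, hmem, -, hj⟩ := X.exists_sortedBorda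
    have h1 : ∀ c : Fin 3, X.borda c = 2 := by decide
    intro j
    rw [hj, List.getD_eq_getElem _ _ (by omega)]
    obtain ⟨c, hc⟩ := (hmem (L[(j : ℕ)]'(by omega))).1 (List.getElem_mem _)
    rw [← hc]
    exact h1 c
  have key : ∀ Z : Election 3 2, ∃ (a b c : ℕ), a + b + c = 6 ∧ b ≤ a ∧ c ≤ b ∧
      (∀ y, (∃ x, Z.borda x = y) → y = a ∨ y = b ∨ y = c) ∧
      dBorda X Z = ((|(2 : ℤ) - a| + |(4 : ℤ) - (a + b)| + |(6 : ℤ) - (a + b + c)| : ℤ) : ℝ) := by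
    intro Z
    obtain ⟨L, hL, hp, hmem, hsum, hj⟩ := Z.exists_sortedBorda
    obtain ⟨a, b, c, rfl⟩ := List.length_eq_three.1 hL
    simp [Fin.sum_univ_three] at hp hsum
    refine ⟨a, b, c, by omega, hp.1.1, hp.2, fun y hy => by simpa using (hmem y).2 hy, ?_⟩
    unfold dBorda
    rw [emd_three, hj, hj, hj, hX, hX, hX]
    simp
  have hXY : dBorda X Y ≠ 0 := by
    intro h0
    obtain ⟨a, b, c, h1, h2, h3, h4, h5⟩ := key Y
    rw [h0] at h5
    have h6 : |(2 : ℤ) - a| + |(4 : ℤ) - (a + b)| + |(6 : ℤ) - (a + b + c)| = 0 := by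
      exact_mod_cast h5.symm
    have h7 : Y.borda (0 : Fin 3) = 4 := by decide
    have := h4 4 ⟨_, h7⟩
    have a1 := abs_nonneg ((2 : ℤ) - a)
    have a2 := abs_nonneg ((4 : ℤ) - (a + b))
    have a3 := abs_nonneg ((6 : ℤ) - (a + b + c))
    have a4 := le_abs_self ((2 : ℤ) - a)
    have a5 := neg_abs_le ((2 : ℤ) - a)
    omega
  obtain ⟨k, E, h0, hk, -, hE⟩ := h 3 2 X Y hXY
  have hk0 : 0 < k := by
    rcases Nat.eq_zero_or_pos k with rfl | hk0
    · refine absurd ?_ hXY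
      rw [← hk, h0]
      exact isGappedVecDist_emd.self _
    · exact hk0
  have hs := hE 0 hk0
  rw [h0] at hs
  obtain ⟨a, b, c, h1, h2, h3, -, h5⟩ := key (E (0 + 1))
  -- The smallest nonzero distance ranges over elections of all sizes, so the pair with two
  -- candidates bounds the first step by 1.
  have hle := hs.2 ⟨one_ne_zero, 2, 2, _, _, dBorda_deviation_two⟩
  have hne := hs.1.1
  rw [h5] at hle hne
  have hle' : |(2 : ℤ) - a| + |(4 : ℤ) - (a + b)| + |(6 : ℤ) - (a + b + c)| ≤ 1 := by
    exact_mod_cast hle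
  have hne' : |(2 : ℤ) - a| + |(4 : ℤ) - (a + b)| + |(6 : ℤ) - (a + b + c)| ≠ 0 := by
    exact_mod_cast hne
  have h6 : (6 : ℤ) - (a + b + c) = 0 := by omega
  rw [h6, abs_zero, add_zero] at hle' hne'
  -- Distance 1 from `(2, 2, 2)` would need one of `(3, 1, 2)`, `(1, 3, 2)`, `(2, 1, 3)`, `(2, 3,
  -- 1)`, none of which is nonincreasing.
  rcases abs_cases ((2 : ℤ) - a) with h | h <;>
    rcases abs_cases ((4 : ℤ) - (a + b)) with h' | h' <;> omega

/-! ### The pairwise metric -/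

/-- The distance of two weighted majority relations over the same candidates. -/
def majorityDist {C : Type} [Fintype C] (M M' : C → C → ℕ) : ℤ :=
  ∑ p : C × C, |(M p.1 p.2 : ℤ) - M' p.1 p.2|

lemma majorityDist_self {C : Type} [Fintype C] (M : C → C → ℕ) : majorityDist M M = 0 := by
  simp [majorityDist]

lemma majorityDist_triangle {C : Type} [Fintype C] (M M' M'' : C → C → ℕ) :
    majorityDist M M'' ≤ majorityDist M M' + majorityDist M' M'' := by
  unfold majorityDist
  rw [← Finset.sum_add_distrib]
  exact Finset.sum_le_sum fun _ _ => abs_sub_le _ _ _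

lemma majorityDist_reindex {C D : Type} [Fintype C] [Fintype D] (σ : D ≃ C) (M M' : C → C → ℕ) :
    (majorityDist (fun a b => M (σ a) (σ b)) fun a b => M' (σ a) (σ b)) = majorityDist M M' :=
  Equiv.sum_comp (σ.prodCongr σ) fun p : C × C => |(M p.1 p.2 : ℤ) - M' p.1 p.2|

namespace Election

variable {m n : ℕ}

lemma majority_self (X : Election m n) (c : X.Cand) : X.majority c c = 0 := by
  simp [Election.majority]

lemma majority_add_majority (X : Election m n) {a b : X.Cand} (h : a ≠ b) :
    X.majority a b + X.majority b a = n := by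
  have h1 : (Finset.univ.filter fun i : Fin n => X.vote i b < X.vote i a) =
      Finset.univ.filter fun i : Fin n => ¬ X.vote i a < X.vote i b := by
    refine Finset.filter_congr fun i _ => ?_
    have : X.vote i a ≠ X.vote i b := fun h' => h ((X.vote i).injective h')
    rw [not_lt]
    exact ⟨le_of_lt, fun h' => lt_of_le_of_ne h' this.symm⟩
  rw [majority, majority, h1, Finset.card_filter_add_card_filter_not, Finset.card_univ,
    Fintype.card_fin]

end Election

section dPair

variable {m n : ℕ}

lemma dPair_eq (X Y : Election m n) : dPair X Y = ⨅ σ : X.Cand ≃ Y.Cand,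
    ((majorityDist X.majority fun a b => Y.majority (σ a) (σ b) : ℤ) : ℝ) := by
  classical
  unfold dPair majorityDist
  refine iInf_congr fun σ => ?_
  push_cast
  refine Finset.sum_subset (Finset.subset_univ _) ?_
  rintro ⟨a, b⟩ - h
  obtain rfl : a = b := by
    by_contra hab
    exact h (Finset.mem_filter.2 ⟨Finset.mem_univ _, hab⟩)
  simp [Election.majority_self]

lemma dPair_le (X Y : Election m n) (σ : X.Cand ≃ Y.Cand) :
    dPair X Y ≤ (majorityDist X.majority fun a b => Y.majority (σ a) (σ b) : ℤ) := by
  rw [dPair_eq]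
  exact finite_iInf_le _ σ

lemma exists_dPair_eq (X Y : Election m n) : ∃ σ : X.Cand ≃ Y.Cand,
    ((majorityDist X.majority fun a b => Y.majority (σ a) (σ b) : ℤ) : ℝ) = dPair X Y := by
  rw [dPair_eq]
  exact exists_eq_ciInf_of_finite

/-- Since `majority a b + majority b a = n`, a discrepancy at `(a, b)` is mirrored at `(b, a)`,
which gives the gap 2. -/
lemma isGapped_dPair : IsGapped dPair 2 where
  pos := two_pos
  self X := by
    refine le_antisymm ((dPair_le X X (Equiv.refl _)).trans ?_) ?_
    · simp [majorityDist_self]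
    · obtain ⟨σ, hσ⟩ := exists_dPair_eq X X
      rw [← hσ]
      exact_mod_cast Finset.sum_nonneg fun _ _ => abs_nonneg _
  triangle X Y Z := by
    obtain ⟨σ, hσ⟩ := exists_dPair_eq X Y
    obtain ⟨τ, hτ⟩ := exists_dPair_eq Y Z
    refine (dPair_le X Z (σ.trans τ)).trans ?_
    rw [← hσ, ← hτ, ← majorityDist_reindex σ]
    exact_mod_cast majorityDist_triangle _ _ _
  gap X Y h := by
    classical
    obtain ⟨σ, hσ⟩ := exists_dPair_eq X Y
    rw [← hσ] at h ⊢
    have h' : (majorityDist X.majority fun a b => Y.majority (σ a) (σ b)) ≠ 0 := by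
      exact_mod_cast h
    obtain ⟨⟨a, b⟩, -, hab⟩ := Finset.exists_ne_zero_of_sum_ne_zero h'
    have hne : a ≠ b := by
      rintro rfl
      simp [Election.majority_self] at hab
    have h1 := X.majority_add_majority hne
    have h2 := Y.majority_add_majority (σ.injective.ne hne)
    have hd : (X.majority a b : ℤ) - Y.majority (σ a) (σ b) ≠ 0 := fun h0 => hab (by simp [h0])
    have h3 := Int.one_le_abs hd
    have h4 : 1 ≤ |(X.majority b a : ℤ) - Y.majority (σ b) (σ a)| :=
      Int.one_le_abs (by omega)
    have h5 := Finset.sum_le_sum_of_subset_of_nonneg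
      (f := fun p : X.Cand × X.Cand =>
        |(X.majority p.1 p.2 : ℤ) - Y.majority (σ p.1) (σ p.2)|)
      (Finset.subset_univ {(a, b), (b, a)}) fun _ _ _ => abs_nonneg _
    rw [Finset.sum_pair (by simp [hne])] at h5
    have h6 : 2 ≤ majorityDist X.majority fun a b => Y.majority (σ a) (σ b) := by
      refine le_trans ?_ h5
      dsimp only
      omega
    exact_mod_cast h6

end dPair

lemma dPair_deviation_two : dPair (deviation 1 (Equiv.refl (Fin 2)))
    (deviation 1 (Equiv.swap (0 : Fin 2) 1)) = 2 := by
  set X := deviation 1 (Equiv.refl (Fin 2))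
  set Y := deviation 1 (Equiv.swap (0 : Fin 2) 1)
  have h1 : (majorityDist X.majority Y.majority) = 2 := by decide
  have hle : dPair X Y ≤ 2 := (dPair_le X Y (Equiv.refl _)).trans
    (le_of_eq (by exact_mod_cast h1))
  refine (isGapped_dPair.eq_zero_or_eq hle).resolve_left fun h0 => ?_
  obtain ⟨σ, hσ⟩ := exists_dPair_eq X Y
  rw [h0] at hσ
  have h2 : (majorityDist X.majority fun a b => Y.majority (σ a) (σ b)) = 0 := by
    exact_mod_cast hσ
  have h3 := (Finset.sum_eq_zero_iff_of_nonneg fun _ _ => abs_nonneg _).1 h2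
    ((0, 1) : Fin 2 × Fin 2) (Finset.mem_univ _)
  have h4 : X.majority (0 : Fin 2) (1 : Fin 2) = 2 := by decide
  have h5 : ∀ a b : Fin 2, Y.majority a b ≤ 1 := by decide
  have h6 := h5 (σ (0 : Fin 2)) (σ (1 : Fin 2))
  have h7 := abs_eq_zero.1 h3
  dsimp only at h7
  omega

/-! ### Two elections without a midpoint -/

/-- The relation `majority` of `noMidpointLeft`. -/
def majorityLeft : Fin 6 → Fin 6 → ℕ :=
  ![![0, 2, 3, 3, 2, 3], ![1, 0, 3, 3, 3, 3], ![0, 0, 0, 3, 2, 2], ![0, 0, 0, 0, 2, 2],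
    ![1, 0, 1, 1, 0, 3], ![0, 0, 1, 1, 0, 0]]

/-- The relation `majority` of `noMidpointRight`. -/
def majorityRight : Fin 6 → Fin 6 → ℕ :=
  ![![0, 2, 2, 2, 2, 3], ![1, 0, 3, 3, 3, 3], ![1, 0, 0, 3, 2, 2], ![1, 0, 0, 0, 2, 2],
    ![1, 0, 1, 1, 0, 3], ![0, 0, 1, 1, 0, 0]]

/-- Two voters rank `0 1 2 3 4 5`, one voter ranks `1 4 0 5 2 3`. -/
abbrev noMidpointLeft : Election 6 3 :=
  Election.ofVotes (Fintype.card_fin 6) ![Equiv.refl _, Equiv.refl _,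
    ⟨![2, 0, 4, 5, 1, 3], ![1, 4, 0, 5, 2, 3], by decide, by decide⟩]

/-- The voters rank `0 1 2 3 4 5`, `0 1 4 5 2 3` and `1 2 3 4 0 5`. -/
abbrev noMidpointRight : Election 6 3 :=
  Election.ofVotes (Fintype.card_fin 6) ![Equiv.refl _,
    ⟨![0, 1, 4, 5, 2, 3], ![0, 1, 4, 5, 2, 3], by decide, by decide⟩,
    ⟨![4, 0, 1, 2, 3, 5], ![1, 2, 3, 4, 0, 5], by decide, by decide⟩]

lemma majority_noMidpointLeft : noMidpointLeft.majority = majorityLeft := by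
  have : ∀ a b : Fin 6, noMidpointLeft.majority a b = majorityLeft a b := by decide
  exact funext fun a => funext fun b => this a b

lemma majority_noMidpointRight : noMidpointRight.majority = majorityRight := by
  have : ∀ a b : Fin 6, noMidpointRight.majority a b = majorityRight a b := by decide
  exact funext fun a => funext fun b => this a b

/-! ### Unanimous and nearly unanimous majorities -/

namespace Election

variable {m n : ℕ} {X : Election m n} {a b c : X.Cand}

lemma lt_of_majority_eq (h : X.majority a b = n) (i : Fin n) : X.vote i a < X.vote i b := by
  have h1 : (Finset.univ.filter fun i : Fin n => X.vote i a < X.vote i b) = Finset.univ :=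
    Finset.eq_univ_of_card _ (by rw [Fintype.card_fin]; exact h)
  simpa using h1.ge (Finset.mem_univ i)

lemma majority_eq_of_trans (hab : X.majority a b = n) (hbc : X.majority b c = n) :
    X.majority a c = n := by
  rw [majority, Finset.filter_true_of_mem, Finset.card_univ, Fintype.card_fin]
  exact fun i _ => (lt_of_majority_eq hab i).trans (lt_of_majority_eq hbc i)

lemma exists_unique_of_majority_add_one_eq (hab : a ≠ b) (h : X.majority a b + 1 = n) :
    ∃ i, X.vote i b < X.vote i a ∧ ∀ j, X.vote j b < X.vote j a → j = i := by
  have h1 := X.majority_add_majority hab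
  obtain ⟨i, hi⟩ := Finset.card_eq_one.1 (show X.majority b a = 1 by omega)
  refine ⟨i, ?_, fun j hj => ?_⟩
  · simpa using hi.ge (Finset.mem_singleton_self i)
  · exact Finset.mem_singleton.1 (hi.le (by simpa using hj))

end Election

/-- The two relations differ only on the pairs `{0, 2}` and `{0, 3}`, so a relation between them has
two mixed candidates to exclude. One violates transitivity of unanimity; in the other, all the
minority opinions are forced onto a single voter, whose vote becomes cyclic. -/
lemma majority_eq_of_midpoint (w : Fin 3 → Vote (Fin 6) 6)
    (h : ∀ a b : Fin 6,
      |(majorityLeft a b : ℤ) - (Election.ofVotes (Fintype.card_fin 6) w).majority a b| +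
        |((Election.ofVotes (Fintype.card_fin 6) w).majority a b : ℤ) - majorityRight a b| =
          |(majorityLeft a b : ℤ) - majorityRight a b|) :
    (Election.ofVotes (Fintype.card_fin 6) w).majority = majorityLeft ∨
      (Election.ofVotes (Fintype.card_fin 6) w).majority = majorityRight := by
  let Z := Election.ofVotes (Fintype.card_fin 6) w
  obtain ⟨M, hM⟩ : ∃ M : Fin 6 → Fin 6 → ℕ, Z.majority = M := ⟨_, rfl⟩
  have hanti : ∀ a b : Fin 6, a ≠ b → M a b + M b a = 3 := fun a b hab =>
    hM ▸ Z.majority_add_majority hab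
  have heq : ∀ a b : Fin 6, M a b + 1 = 3 → a ≠ b →
      ∃ i, w i b < w i a ∧ ∀ j, w j b < w j a → j = i := fun a b h hab =>
    Election.exists_unique_of_majority_add_one_eq (X := Z) hab (hM ▸ h)
  have hall : ∀ a b : Fin 6, M a b = 3 → ∀ i, w i a < w i b := fun a b h i =>
    Election.lt_of_majority_eq (X := Z) (hM ▸ h) i
  have htrans : ∀ a b c : Fin 6, M a b = 3 → M b c = 3 → M a c = 3 := fun a b c hab hbc =>
    hM ▸ Election.majority_eq_of_trans (X := Z) (hM ▸ hab) (hM ▸ hbc)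
  change ∀ a b : Fin 6, |(majorityLeft a b : ℤ) - Z.majority a b| +
    |(Z.majority a b : ℤ) - majorityRight a b| = |(majorityLeft a b : ℤ) - majorityRight a b| at h
  change Z.majority = _ ∨ Z.majority = _
  rw [hM] at h ⊢
  have hsame : ∀ a b : Fin 6, majorityLeft a b = majorityRight a b →
      M a b = majorityLeft a b := by
    intro a b hab
    have h1 := h a b
    rw [← hab, sub_self, abs_zero, abs_sub_comm (M a b : ℤ)] at h1
    have h2 : |(majorityLeft a b : ℤ) - M a b| = 0 := by
      have := abs_nonneg ((majorityLeft a b : ℤ) - M a b)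
      omega
    have := abs_eq_zero.1 h2
    omega
  have hdiff : ∀ a b : Fin 6, majorityLeft a b ≠ majorityRight a b →
      (a = 0 ∧ b = 2) ∨ (a = 0 ∧ b = 3) ∨ (a = 2 ∧ b = 0) ∨ (a = 3 ∧ b = 0) := by decide
  have h20 := hanti 0 2 (by decide)
  have h30 := hanti 0 3 (by decide)
  have hbetween : ∀ x : ℕ, |(3 : ℤ) - x| + |(x : ℤ) - 2| = |(3 : ℤ) - 2| → x = 2 ∨ x = 3 := by
    intro x hx
    norm_num at hx
    have h1 := le_abs_self ((x : ℤ) - 2)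
    have h2 := neg_abs_le ((x : ℤ) - 2)
    have h3 := abs_nonneg ((3 : ℤ) - x)
    have h4 := le_abs_self ((3 : ℤ) - x)
    have h5 := neg_abs_le ((3 : ℤ) - x)
    have h6 := abs_nonneg ((x : ℤ) - 2)
    omega
  have h02 := hbetween _ (h 0 2)
  have h03 := hbetween _ (h 0 3)
  have e23 : M 2 3 = 3 := hsame 2 3 (by decide)
  rcases h02 with h02 | h02 <;> rcases h03 with h03 | h03
  · right
    funext a b
    by_cases hab : majorityLeft a b = majorityRight a b
    · rw [← hab, hsame a b hab]
    · rcases hdiff a b hab with ⟨rfl, rfl⟩ | ⟨rfl, rfl⟩ | ⟨rfl, rfl⟩ | ⟨rfl, rfl⟩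
      · exact h02
      · exact h03
      · exact (by omega : M 2 0 = 1)
      · exact (by omega : M 3 0 = 1)
  · exfalso
    -- Here `M 0 2 = 2` and `M 0 3 = 3`. Voter `i` puts 2, hence 1, above 0. The voter with 4 above
    -- 0 also has 1 above 0, so it is `i`. With 0 above 3 this gives 4 above 3, so `i` is also the
    -- voter with 4 above 2, and then the voter with 5 above 2. Now `i` ranks 5 above 2 above 0
    -- above 5.
    obtain ⟨i, hi, -⟩ := heq 0 2 (by rw [h02]) (by decide)
    have a12 := hall 1 2 (hsame 1 2 (by decide)) i
    have a23 := hall 2 3 e23 i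
    have a05 := hall 0 5 (hsame 0 5 (by decide)) i
    have a45 := hall 4 5 (hsame 4 5 (by decide))
    obtain ⟨i₁, -, u₁⟩ := heq 0 1 (congrArg (· + 1) (hsame 0 1 (by decide))) (by decide)
    obtain ⟨i₂, b₂, -⟩ := heq 0 4 (congrArg (· + 1) (hsame 0 4 (by decide))) (by decide)
    obtain ⟨i₃, -, u₃⟩ := heq 3 4 (congrArg (· + 1) (hsame 3 4 (by decide))) (by decide)
    obtain ⟨i₄, b₄, u₄⟩ := heq 2 4 (congrArg (· + 1) (hsame 2 4 (by decide))) (by decide)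
    obtain ⟨i₅, b₅, -⟩ := heq 2 5 (congrArg (· + 1) (hsame 2 5 (by decide))) (by decide)
    have a14 := hall 1 4 (hsame 1 4 (by decide)) i₂
    have a03 := hall 0 3 h03 i
    have q₂ : i₂ = i := (u₁ i₂ (a14.trans b₂)).trans (u₁ i (a12.trans hi)).symm
    subst q₂
    have q₄ : i₄ = i₂ := (u₃ i₄ (b₄.trans (hall 2 3 e23 i₄))).trans
      (u₃ i₂ (b₂.trans a03)).symm
    subst q₄
    have q₅ : i₅ = i₄ := (u₄ i₅ ((a45 i₅).trans b₅)).trans (u₄ i₄ b₄).symm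
    subst q₅
    exact lt_irrefl _ (((b₅.trans hi).trans a05))
  -- Unanimous 0 over 2 and 2 over 3 force unanimous 0 over 3.
  · exfalso
    have := htrans 0 2 3 h02 e23
    omega
  · left
    funext a b
    by_cases hab : majorityLeft a b = majorityRight a b
    · exact hsame a b hab
    · rcases hdiff a b hab with ⟨rfl, rfl⟩ | ⟨rfl, rfl⟩ | ⟨rfl, rfl⟩ | ⟨rfl, rfl⟩
      · exact h02
      · exact h03
      · exact (by omega : M 2 0 = 0)
      · exact (by omega : M 3 0 = 0)

/-! ### Row-sum scores and uniqueness of the optimal matching -/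

lemma sum_abs_score_le {C : Type} [Fintype C] (M M' : C → C → ℕ) (τ : Equiv.Perm C) :
    ∑ a, |∑ b, (M a b : ℤ) - ∑ b, (M' (τ a) b : ℤ)| ≤
      majorityDist M fun a b => M' (τ a) (τ b) := by
  unfold majorityDist
  rw [Fintype.sum_prod_type]
  refine Finset.sum_le_sum fun a _ => ?_
  rw [← Equiv.sum_comp τ fun b => (M' (τ a) b : ℤ), ← Finset.sum_sub_distrib]
  exact Finset.abs_sum_le_sum_abs _ _

/-- The scores of the candidates in `noMidpointRight`. -/
def scoreRight : Fin 6 → ℤ := ![11, 13, 8, 5, 6, 2]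

lemma scoreRight_top : ∀ x y : Fin 6, x ≠ y → |13 - scoreRight x| + |13 - scoreRight y| ≤ 4 →
    ((x = 0 ∧ y = 1) ∨ (x = 1 ∧ y = 0)) ∧ 2 ≤ |13 - scoreRight x| + |13 - scoreRight y| := by
  decide

lemma scoreRight_middle : ∀ x y z : Fin 6, x ≠ y → x ≠ z → y ≠ z →
    |7 - scoreRight x| + |4 - scoreRight y| + |6 - scoreRight z| ≤ 2 →
      x = 2 ∧ y = 3 ∧ z = 4 := by
  decide

lemma scoreRight_bottom : ∀ x : Fin 6, |2 - scoreRight x| ≤ 2 → x = 5 := by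
  decide

/-- Row sums give a lower bound for the distance. The two left candidates of score 13 must go to the
right scores 11 and 13, costing at least 2; the remaining budget 2 fixes the other four candidates.
Only the transposition of 0 and 1 is left, and it is excluded by direct evaluation. -/
lemma eq_refl_of_majorityDist_le {τ : Equiv.Perm (Fin 6)}
    (h : (majorityDist majorityLeft fun a b => majorityRight (τ a) (τ b)) ≤ 4) :
    τ = Equiv.refl _ := by
  have hs := (sum_abs_score_le majorityLeft majorityRight τ).trans h
  have h1 : ∀ a, ∑ b, (majorityRight a b : ℤ) = scoreRight a := by decide
  have h2 : ∀ a, ∑ b, (majorityLeft a b : ℤ) = (![13, 13, 7, 4, 6, 2] : Fin 6 → ℤ) a := by decide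
  simp only [h1, h2, Fin.sum_univ_six] at hs
  change |(13 : ℤ) - _| + |(13 : ℤ) - _| + |(7 : ℤ) - _| + |(4 : ℤ) - _| + |(6 : ℤ) - _| +
    |(2 : ℤ) - _| ≤ 4 at hs
  have hne : ∀ {a b}, a ≠ b → τ a ≠ τ b := fun h => τ.injective.ne h
  have p0 := abs_nonneg (13 - scoreRight (τ 0))
  have p1 := abs_nonneg (13 - scoreRight (τ 1))
  have p2 := abs_nonneg (7 - scoreRight (τ 2))
  have p3 := abs_nonneg (4 - scoreRight (τ 3))
  have p4 := abs_nonneg (6 - scoreRight (τ 4))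
  have p5 := abs_nonneg (2 - scoreRight (τ 5))
  obtain ⟨h01, h3⟩ := scoreRight_top (τ 0) (τ 1) (hne (by decide)) (by linarith)
  obtain ⟨e2, e3, e4⟩ := scoreRight_middle (τ 2) (τ 3) (τ 4) (hne (by decide)) (hne (by decide))
    (hne (by decide)) (by linarith)
  have e5 := scoreRight_bottom (τ 5) (by linarith)
  rcases h01 with ⟨e0, e1⟩ | ⟨e0, e1⟩
  · ext a
    fin_cases a <;> simp [e0, e1, e2, e3, e4, e5]
  · exfalso
    have hτ : τ = Equiv.swap 0 1 := by
      ext a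
      fin_cases a <;> simp [e0, e1, e2, e3, e4, e5] <;> decide
    subst hτ
    revert h
    decide

theorem not_isIntrinsic_dPair : ¬ IsIntrinsic dPair := by
  intro h
  have hD : dPair noMidpointLeft noMidpointRight ≤ 4 := by
    refine (dPair_le _ _ (Equiv.refl (Fin 6))).trans ?_
    rw [majority_noMidpointLeft, majority_noMidpointRight]
    have : majorityDist majorityLeft majorityRight ≤ 4 := by decide
    exact_mod_cast this
  have hdist : majorityDist majorityLeft majorityRight = 4 := by decide
  have hrefl : ∀ σ : noMidpointLeft.Cand ≃ noMidpointRight.Cand,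
      (majorityDist noMidpointLeft.majority fun a b => noMidpointRight.majority (σ a) (σ b)) ≤ 4 →
        σ = Equiv.refl (Fin 6) := by
    intro σ hσ
    rw [majority_noMidpointLeft, majority_noMidpointRight] at hσ
    exact eq_refl_of_majorityDist_le hσ
  have hge : dPair noMidpointLeft noMidpointRight = 4 := by
    obtain ⟨σ, hσ⟩ := exists_dPair_eq noMidpointLeft noMidpointRight
    have h1 := hrefl σ (by rw [← hσ] at hD; exact_mod_cast hD)
    subst h1
    rw [← hσ, majority_noMidpointLeft, majority_noMidpointRight]
    exact_mod_cast hdist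
  obtain ⟨k, E, h0, hk, hsum, hE⟩ := h 6 3 noMidpointLeft noMidpointRight (by rw [hge]; norm_num)
  have hstep : ∀ i < k, dPair (E i) (E (i + 1)) = 2 := fun i hi =>
    isGapped_dPair.eq_of_isSmallest (by rw [dPair_deviation_two]; norm_num)
      dPair_deviation_two.le (hE i hi)
  rw [Finset.sum_congr rfl fun i hi => hstep i (Finset.mem_range.1 hi), Finset.sum_const,
    Finset.card_range, nsmul_eq_mul, hge] at hsum
  have hk2 : k ≤ 2 := by
    have : (k : ℝ) ≤ 2 := by linarith
    exact_mod_cast this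
  obtain rfl | rfl | rfl : k = 0 ∨ k = 1 ∨ k = 2 := by omega
  · rw [← h0, ← hk, isGapped_dPair.self] at hge
    norm_num at hge
  · have := hstep 0 one_pos
    rw [h0, hk, hge] at this
    norm_num at this
  have s1 := hstep 0 two_pos
  have s2 := hstep 1 one_lt_two
  rw [h0] at s1
  rw [hk] at s2
  generalize E (0 + 1) = Z at s1 s2
  obtain ⟨σ, hσ⟩ := exists_dPair_eq noMidpointLeft Z
  obtain ⟨τ, hτ⟩ := exists_dPair_eq Z noMidpointRight
  rw [s1] at hσ
  rw [s2] at hτ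
  replace hσ : (majorityDist noMidpointLeft.majority fun a b => Z.majority (σ a) (σ b)) = 2 := by
    exact_mod_cast hσ
  replace hτ : (majorityDist Z.majority fun a b => noMidpointRight.majority (τ a) (τ b)) = 2 := by
    exact_mod_cast hτ
  rw [← majorityDist_reindex σ] at hτ
  -- The composite matching has cost at most `2 + 2`, hence is the identity, and the midpoint can be
  -- relabelled by `Fin 6`.
  have hτσ := hrefl (σ.trans τ) ((majorityDist_triangle _ (fun a b => Z.majority (σ a) (σ b))
    _).trans (le_of_eq (by rw [hσ]; exact congrArg (2 + ·) hτ)))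
  have hcomp : ∀ a, τ (σ a) = a := fun a => congrArg (fun f => f a) hτσ
  simp only [hcomp] at hτ
  rw [majority_noMidpointLeft] at hσ
  rw [majority_noMidpointRight] at hτ
  let w : Fin 3 → Vote (Fin 6) 6 := fun i => Equiv.trans σ (Z.vote i)
  have hw : (Election.ofVotes (Fintype.card_fin 6) w).majority =
      fun a b => Z.majority (σ a) (σ b) := rfl
  rw [← hw] at hσ hτ
  have hmid := majority_eq_of_midpoint w ?_
  · rcases hmid with h1 | h1
    · rw [h1, majorityDist_self] at hσ
      norm_num at hσ
    · rw [h1, majorityDist_self] at hτ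
      norm_num at hτ
  · intro a b
    have hle : ∀ p : Fin 6 × Fin 6, |(majorityLeft p.1 p.2 : ℤ) - majorityRight p.1 p.2| ≤
        |(majorityLeft p.1 p.2 : ℤ) -
          (Election.ofVotes (Fintype.card_fin 6) w).majority p.1 p.2| +
        |((Election.ofVotes (Fintype.card_fin 6) w).majority p.1 p.2 : ℤ) -
          majorityRight p.1 p.2| := fun p => abs_sub_le _ _ _
    -- Equality in the summed triangle inequality forces equality in every entry, so the midpoint
    -- lies entrywise between the two relations.
    refine ((Finset.sum_eq_sum_iff_of_le fun p _ => hle p).1 ?_ (a, b) (Finset.mem_univ _)).symm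
    rw [Finset.sum_add_distrib]
    exact hdist.trans (congrArg₂ (· + ·) hσ hτ).symm

theorem theorem4 :
    (IsIntrinsic dSwap ∧ IsIntrinsic dDisc) ∧
    (¬ IsIntrinsic dPosEMD ∧ ¬ IsIntrinsic dPosL1 ∧ ¬ IsIntrinsic dPair ∧ ¬ IsIntrinsic dBorda) ∧
    (IsAlphaIntrinsic 2 dPosEMD ∧ IsAlphaIntrinsic 2 dPosL1) ∧
    (∀ α : ℝ, α < 2 → ¬ IsAlphaIntrinsic α dPosEMD ∧ ¬ IsAlphaIntrinsic α dPosL1) :=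
  ⟨⟨isIntrinsic_dSwap, isIntrinsic_dDisc⟩,
    ⟨not_isAlphaIntrinsic_dPosEMD one_lt_two, not_isAlphaIntrinsic_dPosL1 one_lt_two,
      not_isIntrinsic_dPair, not_isIntrinsic_dBorda⟩,
    ⟨isAlphaIntrinsic_dPosEMD, isAlphaIntrinsic_dPosL1⟩,
    fun _ hα => ⟨not_isAlphaIntrinsic_dPosEMD hα, not_isAlphaIntrinsic_dPosL1 hα⟩⟩
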